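/- Let $$\omega(s)=\sum_{j,k=1}^\infty \frac{1}{\bigl(jk(j+k)\bigr)^s}\qquad(\operatorname{Re}(s)>\tfrac23),$$ where the double series converges absolutely; since the irreducible representations of $SU(3)$ have dimensions $\tfrac12 jk(j+k)$ ($j,k\ge1$), this is, up to the factor $2^{-s}$, the Witten zeta function of $SU(3)$. Then $\omega$ has a unique meromorphic continuation to $\mathbb{C}$ (also denoted $\omega$). The continuation is analytic at the points $0,-1,-2,\ldots$, and there it has the values $$\omega(0)=\tfrac13,\qquad \omega(-n)=0\quad(n=1,2,3,\ldots).$$ -/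

import Mathlib

/-- The summand `1 / (j k (j + k)) ^ s` of the Dirichlet series
`ω(s) = ∑_{j,k ≥ 1} 1 / (j k (j + k)) ^ s = ∑_{j,k ≥ 1} (2 dim W_{j,k}) ^ (-s)`,
where `dim W_{j,k} = j k (j + k) / 2` runs over the dimensions of the irreducible
representations of `SU(3)`. The base is a positive integer. -/
noncomputable def su3WittenTerm (s : ℂ) (p : ℕ+ × ℕ+) : ℂ :=
  1 / ((p.1 : ℂ) * (p.2 : ℂ) * ((p.1 : ℂ) + (p.2 : ℂ))) ^ s

/-- `ω` is the meromorphic continuation to `ℂ` of the series above: on the half-plane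
`Re s > 2/3` the double series converges (absolutely) with sum `ω s`, and `ω` is meromorphic
on all of `ℂ`. The normal form says that removable singularities have been removed, so that the
value of `ω` at a point without a pole is its value as an analytic function there
(at a pole the value is `0` by convention). -/
structure IsSU3WittenZeta (ω : ℂ → ℂ) : Prop where
  meromorphic : MeromorphicNFOn ω Set.univ
  hasSum : ∀ s : ℂ, 2 / 3 < s.re → HasSum (su3WittenTerm s) (ω s)

open Filter Topology Set Complex MeasureTheory

/-! For `Re s > 1` let f(x) = 2 `cosZeta` x s, the Fourier series with coefficient |a|^(-s) at each
nonzero frequency a. The constant term of f³ is the sum of |abc|^(-s) over nonzero a + b + c = 0. In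
such a triple two entries share a sign and the third is minus their sum, so this is 6ω(s); the
symmetry x ↦ 1 - x then gives 3ω(s) = ∫ f³ over [0, 1/2] (`integral_cosZeta_cube`).

By the functional equation, f(x) = G(s) x^(s-1) + Σ a_i(s) x^(2i) on (0, 1/2], with G =
`fourierFactor` and a_i = `cosCoeff i` holomorphic for `Re s < 2`, s ≠ 1 (`two_mul_cosZeta_eq`).
Cubing and integrating term by term produces G³, G², G and 1 times series of terms b_i
(1/2)^(α+2i)/(α+2i), with α = 3s-2 (a single term), 2s-1, s and 1. These series are meromorphic, so
`cubeFinitePart` continues 3ω to the left (`three_mul_tsum_su3WittenTerm`).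

At s = -2m the factor G vanishes. The terms in G³ and G² disappear, while the zero of G meets the
pole of the third series at i = m, leaving 3 G'(-2m) (a*a)_m plus the last term
(`tendsto_cubeFinitePart_neg_even`). For m = 0 one has a_0 = 2ζ(0) = -1, the other a_i vanish and
G'(0) = 1/2, so 3ω(0) = 3/2 - 1/2 = 1. For m ≥ 1 all a_i vanish, a_0 because of the trivial zero of
ζ.

At s = -n with n odd, f is formally G times E(x) = Σ 1/(x+m)^(n+1) over all integers m, so 3ω(-n) is
G³ times the finite part of ∫ E³ over [0, 1/2]. That finite part is L(1/2) for an odd primitive L of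
E³. On a line slightly above the real axis E has only positive frequencies, hence so does E³, and
its integral over a period is 0. Letting the line descend gives L(1/2) = L(-1/2) = -L(1/2), so
L(1/2) = 0 (`cubePrimitive_latticeCoeff_half`). -/

/-! ### Binomial series and the Taylor expansion of shifted power sums -/

theorem ring_choose_succ_mul (w : ℂ) (n : ℕ) :
    Ring.choose w (n + 1) * ((n : ℂ) + 1) = Ring.choose w n * (w - n) := by
  have h : ((n.factorial : ℂ)) ≠ 0 := by exact_mod_cast n.factorial_ne_zero
  have h' : ((n : ℂ) + 1) ≠ 0 := by exact_mod_cast n.succ_ne_zero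
  rw [Ring.choose_eq_smul, Ring.choose_eq_smul, Nat.factorial_succ]
  simp only [descPochhammer_succ_right, Polynomial.smeval_mul, Polynomial.smeval_natCast,
    Polynomial.smeval_sub, Polynomial.smeval_X, smul_eq_mul, pow_one, pow_zero, nsmul_eq_mul,
    mul_one]
  push_cast
  field_simp

theorem ring_choose_succ (w : ℂ) (n : ℕ) :
    Ring.choose w (n + 1) = Ring.choose w n * (w - n) / ((n : ℂ) + 1) := by
  rw [eq_div_iff (by exact_mod_cast n.succ_ne_zero), ring_choose_succ_mul]

theorem differentiable_ring_choose (n : ℕ) : Differentiable ℂ fun w : ℂ => Ring.choose w n := by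
  induction n with
  | zero => simp
  | succ n ih =>
    simp_rw [ring_choose_succ]
    fun_prop

/-- Passing from n to n + 1 multiplies the left side by |w - n|/(n + 1), at most (n + K + 1)/(n +
1), which is exactly the ratio of consecutive right sides. -/
theorem norm_ring_choose_le (K : ℕ) {w : ℂ} (hw : ‖w‖ ≤ K + 1) (n : ℕ) :
    ‖Ring.choose w n‖ ≤ ((n + K).choose K : ℝ) := by
  induction n with
  | zero => simp
  | succ n ih =>
    have hn : (0 : ℝ) < n + 1 := by positivity
    have h1 : ‖((n : ℂ) + 1)‖ = n + 1 := by
      rw [← Nat.cast_succ, Complex.norm_natCast]; simp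
    rw [ring_choose_succ, norm_div, norm_mul, h1, div_le_iff₀ hn]
    have h2 : ‖w - n‖ ≤ n + K + 1 := by
      refine (norm_sub_le _ _).trans ?_
      rw [Complex.norm_natCast]; linarith
    have h3 : ((n + 1 + K).choose K : ℝ) * (n + 1) = (n + K).choose K * (n + K + 1) := by
      have := Nat.choose_mul_succ_eq (n + K) K
      rw [show n + K + 1 - K = n + 1 by omega] at this
      rw [show n + 1 + K = n + K + 1 by ring]
      exact_mod_cast this.symm
    rw [h3]
    exact mul_le_mul ih h2 (norm_nonneg _) (by positivity)

/-- The growth in i is only polynomial, locally uniformly in w. The crude rate 2 suffices because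
the series are used at |x| ≤ 1/2, where x^(2i) ≤ 4^(-i). -/
theorem exists_norm_ring_choose_even_le (R : ℝ) :
    ∃ C : ℝ, 0 ≤ C ∧ ∀ w : ℂ, ‖w‖ ≤ R → ∀ i : ℕ, ‖Ring.choose w (2 * i)‖ ≤ C * 2 ^ i := by
  obtain ⟨K, hK⟩ := exists_nat_ge R
  set r : ℝ := √2⁻¹ with hr
  have hr0 : 0 < r := by positivity
  have hr2 : r ^ 2 = 2⁻¹ := Real.sq_sqrt (by norm_num)
  have hr1 : r < 1 := by nlinarith
  have hs := summable_choose_mul_geometric_of_norm_lt_one (R := ℝ) K (r := r)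
    (by rwa [Real.norm_of_nonneg hr0.le])
  obtain ⟨C, hC⟩ := hs.tendsto_atTop_zero.bddAbove_range
  have hC' : ∀ n : ℕ, ((n + K).choose K : ℝ) * r ^ n ≤ C := fun n => hC ⟨n, rfl⟩
  refine ⟨C, le_trans (by positivity) (hC' 0), fun w hw i => ?_⟩
  refine (norm_ring_choose_le K (by linarith) _).trans ?_
  have h := hC' (2 * i)
  rw [pow_mul, hr2] at h
  calc (((2 * i + K).choose K : ℕ) : ℝ)
      = ((2 * i + K).choose K : ℝ) * 2⁻¹ ^ i * 2 ^ i := by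
        rw [mul_assoc, ← mul_pow]; norm_num
    _ ≤ C * 2 ^ i := by gcongr

theorem hasSum_binomial_even (w : ℂ) {u : ℂ} (hu : ‖u‖ < 1) :
    HasSum (fun i : ℕ => 2 * Ring.choose w (2 * i) * u ^ (2 * i)) ((1 + u) ^ w + (1 - u) ^ w) := by
  have key : ∀ v : ℂ, ‖v‖ < 1 →
      HasSum (fun n : ℕ => Ring.choose w n * v ^ n) ((1 + v) ^ w) := by
    intro v hv
    have h := (one_add_cpow_hasFPowerSeriesOnBall_zero (a := w)).hasSum (y := v)
      (by simpa [← ENNReal.ofReal_one, Metric.eball_ofReal] using hv)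
    simpa [binomialSeries, FormalMultilinearSeries.coeff_ofScalars, mul_comm] using h
  have h := (key u hu).add (key (-u) (by simpa using hu))
  have hinj : Function.Injective (fun i : ℕ => 2 * i) := fun a b h => by simpa using h
  rw [← hinj.hasSum_iff] at h
  · rw [sub_eq_add_neg]
    convert h using 2 with i
    simp [pow_mul]; ring
  · intro n hn
    have : Odd n := by
      rw [← Nat.not_even_iff_odd]
      rintro ⟨k, hk⟩
      exact hn ⟨k, by simp; omega⟩
    simp [this.neg_pow]

/-- A positive factor does not change the argument, so the principal branches are compatible. -/
theorem mul_cpow_of_pos {r : ℝ} (hr : 0 < r) {u : ℂ} (hu : u ≠ 0) (w : ℂ) :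
    ((r : ℂ) * u) ^ w = (r : ℂ) ^ w * u ^ w := by
  have hr' : (r : ℂ) ≠ 0 := by exact_mod_cast hr.ne'
  rw [cpow_def_of_ne_zero (mul_ne_zero hr' hu), cpow_def_of_ne_zero hr', cpow_def_of_ne_zero hu,
    log_ofReal_mul hr hu, ← Complex.exp_add, ← ofReal_log hr.le]
  ring_nf

theorem summable_norm_succ_cpow {w : ℂ} (hw : w.re < -1) :
    Summable fun m : ℕ => ‖((m : ℂ) + 1) ^ w‖ := by
  have h := (Real.summable_nat_rpow (p := w.re)).2 hw
  refine ((summable_nat_add_iff 1).2 h).congr fun m => ?_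
  rw [← Nat.cast_succ, norm_natCast_cpow_of_pos m.succ_pos]

theorem tsum_succ_cpow {w : ℂ} (hw : w.re < -1) :
    ∑' m : ℕ, ((m : ℂ) + 1) ^ w = riemannZeta (-w) := by
  rw [zeta_eq_tsum_one_div_nat_add_one_cpow (by simp; linarith)]
  simp [cpow_neg]

theorem summable_binomial_even_norm (w : ℂ) {r : ℝ} (hr0 : 0 ≤ r) (hr : r ^ 2 < 1 / 2) :
    Summable fun i : ℕ => ‖2 * Ring.choose w (2 * i)‖ * r ^ (2 * i) := by
  obtain ⟨C, hC0, hC⟩ := exists_norm_ring_choose_even_le ‖w‖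
  have hg : Summable fun i : ℕ => 2 * C * (2 * r ^ 2) ^ i :=
    (summable_geometric_of_lt_one (by positivity) (by linarith)).mul_left _
  refine hg.of_nonneg_of_le (fun i => by positivity) fun i => ?_
  rw [norm_mul, Complex.norm_ofNat, pow_mul, mul_pow]
  calc 2 * ‖Ring.choose w (2 * i)‖ * (r ^ 2) ^ i ≤ 2 * (C * 2 ^ i) * (r ^ 2) ^ i := by
        gcongr; exact hC w le_rfl i
    _ = _ := by ring

/-- Taylor expansion of `∑ ((m + 1 + z) ^ w + (m + 1 - z) ^ w)` around `z = 0`. -/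
theorem hasSum_shifted_cpow {w z : ℂ} (hw : w.re < -1) (hz : ‖z‖ ^ 2 < 1 / 2) :
    HasSum (fun m : ℕ => ((m : ℂ) + 1 + z) ^ w + ((m : ℂ) + 1 - z) ^ w)
        (∑' i : ℕ, 2 * Ring.choose w (2 * i) * riemannZeta (2 * i - w) * z ^ (2 * i)) ∧
      Summable fun i : ℕ => 2 * Ring.choose w (2 * i) * riemannZeta (2 * i - w) * z ^ (2 * i) := by
  set f : ℕ × ℕ → ℂ := fun p =>
    2 * Ring.choose w (2 * p.2) * ((p.1 : ℂ) + 1) ^ (w - 2 * p.2) * z ^ (2 * p.2) with hf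
  have hz1 : ‖z‖ < 1 := by nlinarith [norm_nonneg z]
  have hnorm : ∀ (m i : ℕ), ‖((m : ℂ) + 1) ^ (w - 2 * i)‖ ≤ ‖((m : ℂ) + 1) ^ w‖ := by
    intro m i
    rw [← Nat.cast_succ, norm_natCast_cpow_of_pos m.succ_pos, norm_natCast_cpow_of_pos m.succ_pos]
    refine Real.rpow_le_rpow_of_exponent_le (by simp) ?_
    simp
  -- Lowering the exponent w by 2i only shrinks the power of m + 1 ≥ 1, so a product of two summable
  -- families dominates the double series. Summing it over i gives binomial series, summing it over
  -- m gives zeta values.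
  have hfs : Summable f := by
    refine Summable.of_norm_bounded (((summable_norm_succ_cpow hw).mul_of_nonneg
      (summable_binomial_even_norm w (norm_nonneg z) hz) (fun _ => norm_nonneg _)
      (fun _ => by positivity))) ?_
    rintro ⟨m, i⟩
    simp only [hf]
    rw [norm_mul, norm_mul, norm_pow, mul_comm ‖2 * _‖, mul_assoc]
    gcongr
    exact hnorm m i
  have hrow : ∀ m : ℕ, HasSum (fun i => f (m, i))
      (((m : ℂ) + 1 + z) ^ w + ((m : ℂ) + 1 - z) ^ w) := by
    intro m
    have hm : (0 : ℝ) < (m : ℝ) + 1 := by positivity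
    have hm' : ((m : ℂ) + 1) ≠ 0 := by exact_mod_cast hm.ne'
    have hu : ‖z / ((m : ℂ) + 1)‖ < 1 := by
      rw [norm_div, ← Nat.cast_succ, Complex.norm_natCast]
      refine (div_le_self (norm_nonneg z) ?_).trans_lt hz1
      simp
    have h1 : (1 + z / ((m : ℂ) + 1)) ≠ 0 := by
      intro h
      have h0 : z / ((m : ℂ) + 1) = -1 := by linear_combination h
      rw [h0] at hu; simp at hu
    have h2 : (1 - z / ((m : ℂ) + 1)) ≠ 0 := by
      intro h
      have h0 : z / ((m : ℂ) + 1) = 1 := by linear_combination -h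
      rw [h0] at hu; simp at hu
    have h := (hasSum_binomial_even w hu).mul_left (((m : ℂ) + 1) ^ w)
    have e1 := mul_cpow_of_pos hm h1 w
    have e2 := mul_cpow_of_pos hm h2 w
    push_cast at e1 e2
    rw [mul_add, ← e1, ← e2, mul_add, mul_sub, mul_div_cancel₀ _ hm', mul_one] at h
    refine h.congr_fun fun i => ?_
    simp only [hf]
    rw [cpow_sub _ _ hm', div_pow,
      show (2 * (i : ℂ)) = ((2 * i : ℕ) : ℂ) by push_cast; ring, cpow_natCast]
    ring
  have hcol : ∀ i : ℕ, ∑' m, f (m, i)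
      = 2 * Ring.choose w (2 * i) * riemannZeta (2 * i - w) * z ^ (2 * i) := by
    intro i
    have : (0 : ℝ) ≤ i := by positivity
    rw [← neg_sub, ← tsum_succ_cpow (by simp; linarith), ← tsum_mul_left, ← tsum_mul_right]
  have hsum := hfs.hasSum.prod_fiberwise hrow
  have hcs : Summable fun i => ∑' m, f (m, i) := hfs.prod_symm.prod
  simp_rw [hcol] at hcs
  refine ⟨?_, hcs⟩
  convert hsum using 1
  rw [← (Equiv.prodComm ℕ ℕ).tsum_eq f]
  refine Eq.trans (tsum_congr fun i => (hcol i).symm) ?_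
  exact (Summable.tsum_prod (f := fun p => f (Equiv.prodComm ℕ ℕ p)) hfs.prod_symm).symm

/-! ### Finite part integrals of power series with geometrically bounded coefficients -/

/-- A sequence of functions, holomorphic on `U` and locally uniformly `O(ρ ^ i)`. -/
structure GeomBounded (b : ℕ → ℂ → ℂ) (U : Set ℂ) (ρ : ℝ) : Prop where
  differentiableOn : ∀ i, DifferentiableOn ℂ (b i) U
  bound : ∀ s₀ ∈ U, ∃ C : ℝ, 0 ≤ C ∧ ∀ᶠ s in 𝓝 s₀, ∀ i, ‖b i s‖ ≤ C * ρ ^ i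

/-- The coefficients of the product of two power series. -/
def seqConv (a b : ℕ → ℂ) (i : ℕ) : ℂ := ∑ p ∈ Finset.HasAntidiagonal.antidiagonal i, a p.1 * b p.2

/-- The value of the finite part integral of `x ^ (α - 1) * ∑ b i * x ^ (2 * i)` on `[0, 1 / 2]`. -/
noncomputable def finitePart (b : ℕ → ℂ) (α : ℂ) : ℂ :=
  ∑' i : ℕ, b i * ((1 / 2 : ℂ) ^ (α + 2 * i) / (α + 2 * i))

theorem sum_antidiagonal_two_pow_mul_three_pow_le (i : ℕ) :
    ∑ p ∈ Finset.HasAntidiagonal.antidiagonal i, (2 : ℝ) ^ p.1 * 3 ^ p.2 ≤ 3 * 3 ^ i := by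
  induction i with
  | zero => simp
  | succ i ih =>
    rw [Finset.Nat.sum_antidiagonal_succ]
    simp only [pow_succ, pow_zero, one_mul]
    have : ∑ p ∈ Finset.HasAntidiagonal.antidiagonal i, (2 : ℝ) ^ p.1 * 2 * 3 ^ p.2
        = 2 * ∑ p ∈ Finset.HasAntidiagonal.antidiagonal i, (2 : ℝ) ^ p.1 * 3 ^ p.2 := by
      rw [Finset.mul_sum]; exact Finset.sum_congr rfl fun p _ => by ring
    rw [this]; linarith

/-- Because the rates 2 and 3 differ, convolution keeps the rate 3 without a polynomial loss. Thus
it can be iterated to reach cubes, and 3 < 4 still gives convergence at x = 1/2. -/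
theorem norm_seqConv_le {a b : ℕ → ℂ} {A B : ℝ} (hA : 0 ≤ A)
    (ha : ∀ i, ‖a i‖ ≤ A * 2 ^ i) (hb : ∀ i, ‖b i‖ ≤ B * 3 ^ i) (i : ℕ) :
    ‖seqConv a b i‖ ≤ 3 * A * B * 3 ^ i := by
  have hB : 0 ≤ B := by simpa using (norm_nonneg _).trans (hb 0)
  refine (norm_sum_le _ _).trans ?_
  calc ∑ p ∈ Finset.HasAntidiagonal.antidiagonal i, ‖a p.1 * b p.2‖
      ≤ ∑ p ∈ Finset.HasAntidiagonal.antidiagonal i, A * B * ((2 : ℝ) ^ p.1 * 3 ^ p.2) := by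
        refine Finset.sum_le_sum fun p _ => ?_
        rw [norm_mul]
        calc ‖a p.1‖ * ‖b p.2‖ ≤ (A * 2 ^ p.1) * (B * 3 ^ p.2) :=
              mul_le_mul (ha _) (hb _) (norm_nonneg _) (by positivity)
          _ = _ := by ring
    _ ≤ A * B * (3 * 3 ^ i) := by
        rw [← Finset.mul_sum]
        exact mul_le_mul_of_nonneg_left (sum_antidiagonal_two_pow_mul_three_pow_le i)
          (by positivity)
    _ = _ := by ring

theorem GeomBounded.mono_two_three {a : ℕ → ℂ → ℂ} {U : Set ℂ} (ha : GeomBounded a U 2) :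
    GeomBounded a U 3 := by
  refine ⟨ha.differentiableOn, fun s₀ hs₀ => ?_⟩
  obtain ⟨C, hC, h⟩ := ha.bound s₀ hs₀
  refine ⟨C, hC, h.mono fun s hs i => (hs i).trans ?_⟩
  gcongr; norm_num

theorem GeomBounded.conv {a b : ℕ → ℂ → ℂ} {U : Set ℂ} (ha : GeomBounded a U 2)
    (hb : GeomBounded b U 3) :
    GeomBounded (fun i s => seqConv (a · s) (b · s) i) U 3 := by
  refine ⟨fun i => ?_, fun s₀ hs₀ => ?_⟩
  · unfold seqConv
    exact DifferentiableOn.fun_sum fun p _ =>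
      (ha.differentiableOn p.1).mul (hb.differentiableOn p.2)
  · obtain ⟨A, hA, h1⟩ := ha.bound s₀ hs₀
    obtain ⟨B, hB, h2⟩ := hb.bound s₀ hs₀
    refine ⟨3 * A * B, by positivity, ?_⟩
    filter_upwards [h1, h2] with s k1 k2
    exact norm_seqConv_le hA k1 k2

theorem norm_half_cpow (w : ℂ) : ‖(1 / 2 : ℂ) ^ w‖ = (1 / 2 : ℝ) ^ w.re := by
  have := norm_cpow_eq_rpow_re_of_pos (x := 1 / 2) (by norm_num) w
  simpa using this

theorem norm_half_cpow_add (α : ℂ) (j : ℕ) :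
    ‖(1 / 2 : ℂ) ^ (α + 2 * j)‖ = (1 / 2 : ℝ) ^ α.re * (1 / 4) ^ j := by
  rw [norm_half_cpow]
  have : (α + 2 * (j : ℂ)).re = α.re + 2 * j := by simp
  rw [this, Real.rpow_add (by norm_num), Real.rpow_mul (by norm_num), Real.rpow_natCast]
  norm_num

theorem finitePart_term_bound {b : ℕ → ℂ} {α : ℂ} {C A : ℝ} (hA : ‖α‖ ≤ A)
    (hb : ∀ i, ‖b i‖ ≤ C * 3 ^ i) {j : ℕ} (hj : A + 1 ≤ 2 * j) :
    ‖b j * ((1 / 2 : ℂ) ^ (α + 2 * j) / (α + 2 * j))‖ ≤ C * 2 ^ A * (3 / 4) ^ j := by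
  have hC : 0 ≤ C := by simpa using (norm_nonneg _).trans (hb 0)
  have h1 : (1 : ℝ) ≤ ‖α + 2 * j‖ := by
    have := norm_sub_norm_le (2 * (j : ℂ)) (-α)
    rw [norm_neg, sub_neg_eq_add, add_comm] at this
    have e : ‖2 * (j : ℂ)‖ = 2 * j := by simp
    linarith
  rw [norm_mul, norm_div, norm_half_cpow_add]
  have h2 : (1 / 2 : ℝ) ^ α.re ≤ 2 ^ A := by
    rw [one_div, Real.inv_rpow (by norm_num), ← Real.rpow_neg (by norm_num)]
    refine Real.rpow_le_rpow_of_exponent_le (by norm_num) ?_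
    linarith [neg_abs_le α.re, abs_re_le_norm α]
  calc ‖b j‖ * ((1 / 2 : ℝ) ^ α.re * (1 / 4) ^ j / ‖α + 2 * j‖)
      ≤ (C * 3 ^ j) * (2 ^ A * (1 / 4) ^ j / 1) := by
        gcongr
        exact hb j
    _ = C * 2 ^ A * (3 / 4) ^ j := by
        rw [div_one, show (3 / 4 : ℝ) = 3 * (1 / 4) by norm_num, mul_pow]; ring

theorem summable_finitePart {b : ℕ → ℂ} (α : ℂ) {C : ℝ} (hb : ∀ i, ‖b i‖ ≤ C * 3 ^ i) :
    Summable fun i : ℕ => b i * ((1 / 2 : ℂ) ^ (α + 2 * i) / (α + 2 * i)) := by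
  obtain ⟨N, hN⟩ := exists_nat_ge (‖α‖ + 1)
  refine Summable.of_norm_bounded_eventually_nat
    (g := fun j : ℕ => C * 2 ^ ‖α‖ * (3 / 4 : ℝ) ^ j)
    ((summable_geometric_of_lt_one (by norm_num) (by norm_num)).mul_left _) ?_
  filter_upwards [eventually_ge_atTop N] with j hj
  refine finitePart_term_bound le_rfl hb ?_
  have : (N : ℝ) ≤ j := by exact_mod_cast hj
  linarith [(j.cast_nonneg : (0 : ℝ) ≤ j)]

/-- All but finitely many denominators α + 2i stay away from 0 near s₀, and the corresponding tail
converges uniformly, like a geometric series of ratio 3/4. Poles can only come from the finite sum;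
the bound `N₀` forces a chosen index into it. -/
theorem finitePart_decomp {b : ℕ → ℂ → ℂ} {U : Set ℂ} (hU : IsOpen U) (hb : GeomBounded b U 3)
    {α : ℂ → ℂ} (hα : Differentiable ℂ α) {s₀ : ℂ} (hs₀ : s₀ ∈ U) (N₀ : ℕ) :
    ∃ N, N₀ ≤ N ∧ ∃ h : ℂ → ℂ, AnalyticAt ℂ h s₀ ∧ ∀ᶠ s in 𝓝 s₀, finitePart (b · s) (α s) =
      ∑ i ∈ Finset.range N, b i s * ((1 / 2 : ℂ) ^ (α s + 2 * i) / (α s + 2 * i)) + h s := by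
  obtain ⟨C, hC, hbd⟩ := hb.bound s₀ hs₀
  set A : ℝ := ‖α s₀‖ + 1 with hA
  obtain ⟨M, hM⟩ := exists_nat_ge (A + 1)
  have hev : ∀ᶠ s in 𝓝 s₀, ‖α s‖ ≤ A :=
    ((hα.continuous.norm.tendsto s₀).eventually (gt_mem_nhds (lt_add_one _))).mono fun _ h => h.le
  obtain ⟨V, hV, hVo, hVs⟩ := _root_.eventually_nhds_iff.1 ((hbd.and hev).and (hU.mem_nhds hs₀))
  refine ⟨max N₀ M, le_max_left _ _, fun s => ∑' i : ℕ, b (i + max N₀ M) s *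
    ((1 / 2 : ℂ) ^ (α s + 2 * (i + max N₀ M : ℕ)) / (α s + 2 * (i + max N₀ M : ℕ))), ?_, ?_⟩
  · set N := max N₀ M
    have hNM : (M : ℝ) ≤ N := by exact_mod_cast le_max_right _ _
    have hlarge : ∀ i : ℕ, A + 1 ≤ 2 * (i + N : ℕ) := by
      intro i
      push_cast
      linarith [(i.cast_nonneg : (0 : ℝ) ≤ i), (N.cast_nonneg : (0 : ℝ) ≤ N)]
    refine (differentiableOn_tsum_of_summable_norm
      (u := fun i : ℕ => C * 2 ^ A * (3 / 4 : ℝ) ^ (i + N)) ?_ ?_ hVo ?_).analyticAt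
      (hVo.mem_nhds hVs)
    · exact ((summable_nat_add_iff N).2
        (summable_geometric_of_lt_one (by norm_num) (by norm_num))).mul_left _
    · intro i
      refine DifferentiableOn.mul ((hb.differentiableOn _).mono fun s hs => (hV s hs).2) ?_
      have h0 : DifferentiableOn ℂ (fun s => α s + 2 * (i + N : ℕ)) V :=
        (hα.add_const _).differentiableOn
      refine DifferentiableOn.div ?_ h0 ?_
      · exact h0.const_cpow (Or.inl (by norm_num))
      · intro s hs h
        have h1 := (hV s hs).1.2
        have h2 : α s = -(2 * (i + N : ℕ)) := eq_neg_of_add_eq_zero_left h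
        rw [h2, norm_neg, norm_mul, Complex.norm_natCast, Complex.norm_ofNat] at h1
        linarith [hlarge i]
    · intro i s hs
      exact finitePart_term_bound (hV s hs).1.2 (hV s hs).1.1 (hlarge i)
  · filter_upwards [hVo.mem_nhds hVs] with s hs
    exact ((summable_finitePart (α s) (hV s hs).1.1).sum_add_tsum_nat_add _).symm

theorem analyticAt_finitePart_term {b : ℂ → ℂ} {s₀ : ℂ} (hb : AnalyticAt ℂ b s₀)
    {α : ℂ → ℂ} (hα : Differentiable ℂ α) {i : ℕ} (h : α s₀ + 2 * i ≠ 0) :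
    AnalyticAt ℂ (fun s => b s * ((1 / 2 : ℂ) ^ (α s + 2 * i) / (α s + 2 * i))) s₀ := by
  have h0 : AnalyticAt ℂ (fun s => α s + 2 * (i : ℂ)) s₀ := (hα.add_const _).analyticAt _
  have h1 : AnalyticAt ℂ (fun s => (1 / 2 : ℂ) ^ (α s + 2 * (i : ℂ))) s₀ :=
    Differentiable.analyticAt (fun s => ((hα.add_const _) s).const_cpow (Or.inl (by norm_num))) _
  exact hb.mul (h1.div h0 h)

theorem meromorphicAt_finitePart {b : ℕ → ℂ → ℂ} {U : Set ℂ} (hU : IsOpen U)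
    (hb : GeomBounded b U 3) {α : ℂ → ℂ} (hα : Differentiable ℂ α) {s₀ : ℂ} (hs₀ : s₀ ∈ U) :
    MeromorphicAt (fun s => finitePart (b · s) (α s)) s₀ := by
  obtain ⟨N, -, h, hh, he⟩ := finitePart_decomp hU hb hα hs₀ 0
  refine MeromorphicAt.congr ?_ ((he.filter_mono nhdsWithin_le_nhds).mono fun s hs => hs.symm)
  refine MeromorphicAt.add (MeromorphicAt.fun_sum fun i _ => ?_) hh.meromorphicAt
  have h0 : AnalyticAt ℂ (fun s => α s + 2 * (i : ℂ)) s₀ := (hα.add_const _).analyticAt _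
  have h1 : AnalyticAt ℂ (fun s => (1 / 2 : ℂ) ^ (α s + 2 * (i : ℂ))) s₀ :=
    Differentiable.analyticAt (fun s => ((hα.add_const _) s).const_cpow (Or.inl (by norm_num))) _
  exact (((hb.differentiableOn i).analyticAt (hU.mem_nhds hs₀)).meromorphicAt).mul
    (h1.meromorphicAt.div h0.meromorphicAt)

theorem analyticAt_finitePart {b : ℕ → ℂ → ℂ} {U : Set ℂ} (hU : IsOpen U)
    (hb : GeomBounded b U 3) {α : ℂ → ℂ} (hα : Differentiable ℂ α) {s₀ : ℂ} (hs₀ : s₀ ∈ U)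
    (h0 : ∀ i : ℕ, α s₀ + 2 * i ≠ 0) :
    AnalyticAt ℂ (fun s => finitePart (b · s) (α s)) s₀ := by
  obtain ⟨N, -, h, hh, he⟩ := finitePart_decomp hU hb hα hs₀ 0
  refine AnalyticAt.congr ?_ (he.mono fun s hs => hs.symm)
  exact (Finset.analyticAt_fun_sum _ fun i _ => analyticAt_finitePart_term
    ((hb.differentiableOn i).analyticAt (hU.mem_nhds hs₀)) hα (h0 i)).add hh

/-- At an exponent `α s₀ = -2 * k` only the `k`-th term of the finite part is singular. -/
theorem finitePart_eq_singular_term_add {b : ℕ → ℂ → ℂ} {U : Set ℂ} (hU : IsOpen U)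
    (hb : GeomBounded b U 3) {α : ℂ → ℂ} (hα : Differentiable ℂ α) {s₀ : ℂ} (hs₀ : s₀ ∈ U) {k : ℕ}
    (hk : α s₀ + 2 * k = 0) :
    ∃ h : ℂ → ℂ, AnalyticAt ℂ h s₀ ∧ ∀ᶠ s in 𝓝 s₀, finitePart (b · s) (α s) =
      b k s * ((1 / 2 : ℂ) ^ (α s + 2 * k) / (α s + 2 * k)) + h s := by
  obtain ⟨N, hN, h, hh, he⟩ := finitePart_decomp hU hb hα hs₀ (k + 1)
  refine ⟨fun s => ∑ i ∈ (Finset.range N).erase k,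
    b i s * ((1 / 2 : ℂ) ^ (α s + 2 * i) / (α s + 2 * i)) + h s,
    (Finset.analyticAt_fun_sum _ fun i hi => analyticAt_finitePart_term
      ((hb.differentiableOn i).analyticAt (hU.mem_nhds hs₀)) hα fun h0 => ?_).add hh, ?_⟩
  · refine (Finset.mem_erase.1 hi).1 ?_
    have h1 : (2 * i : ℂ) = 2 * k := by linear_combination h0 - hk
    exact_mod_cast mul_left_cancel₀ two_ne_zero h1
  · filter_upwards [he] with s hs
    rw [hs, ← Finset.add_sum_erase _ _ (Finset.mem_range.2 (show k < N by omega)), add_assoc]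

theorem summable_powerSeries {b : ℕ → ℂ} {C r : ℝ} (hb : ∀ i, ‖b i‖ ≤ C * 3 ^ i) {z : ℂ}
    (hz : ‖z‖ ≤ r) (hr : 3 * r ^ 2 < 1) :
    Summable (fun i : ℕ => C * (3 * r ^ 2) ^ i) ∧ ∀ i, ‖b i * z ^ (2 * i)‖ ≤ C * (3 * r ^ 2) ^ i := by
  have hC : 0 ≤ C := by simpa using (norm_nonneg _).trans (hb 0)
  refine ⟨(summable_geometric_of_lt_one (by positivity) hr).mul_left _, fun i => ?_⟩
  rw [norm_mul, norm_pow, pow_mul, mul_pow, ← mul_assoc]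
  gcongr
  exact hb i

theorem continuousOn_powerSeries {b : ℕ → ℂ} {C : ℝ} (hb : ∀ i, ‖b i‖ ≤ C * 3 ^ i) :
    ContinuousOn (fun x : ℝ => ∑' i : ℕ, b i * (x : ℂ) ^ (2 * i)) (Icc 0 (1 / 2)) := by
  have hC := (summable_powerSeries hb (z := 0) (r := 1 / 2) (by simp) (by norm_num)).1
  refine continuousOn_tsum (fun i => by fun_prop) hC fun i x hx => ?_
  refine (summable_powerSeries hb (r := 1 / 2) ?_ (by norm_num)).2 i
  rw [norm_real, Real.norm_of_nonneg hx.1]; exact hx.2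

/-- For `Re α > 0` the integral converges and may be computed term by term, since the integrals of
the norms are dominated by a geometric series of ratio 3/4. -/
theorem integral_powerSeries {b : ℕ → ℂ} {C : ℝ} (hb : ∀ i, ‖b i‖ ≤ C * 3 ^ i) {α : ℂ}
    (hα : 0 < α.re) :
    IntegrableOn (fun x : ℝ => (x : ℂ) ^ (α - 1) * ∑' i : ℕ, b i * (x : ℂ) ^ (2 * i))
        (Ioc 0 (1 / 2)) ∧
      ∫ x : ℝ in Ioc 0 (1 / 2), (x : ℂ) ^ (α - 1) * ∑' i : ℕ, b i * (x : ℂ) ^ (2 * i) =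
        finitePart b α := by
  have hC : 0 ≤ C := by simpa using (norm_nonneg _).trans (hb 0)
  have hint : ∀ β : ℂ, 0 < β.re →
      IntegrableOn (fun x : ℝ => (x : ℂ) ^ (β - 1)) (Ioc 0 (1 / 2)) := fun β hβ =>
    (intervalIntegrable_iff_integrableOn_Ioc_of_le (by norm_num)).1
      (intervalIntegral.intervalIntegrable_cpow' (by simpa using hβ))
  refine ⟨?_, ?_⟩
  · have h1 : IntegrableOn (fun x : ℝ => (x : ℂ) ^ (α - 1)) (Icc 0 (1 / 2)) :=
      (integrableOn_Icc_iff_integrableOn_Ioc (by simp)).2 (hint α hα)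
    exact (h1.mul_continuousOn (continuousOn_powerSeries hb) isCompact_Icc).mono_set
      Ioc_subset_Icc_self
  · set F : ℕ → ℝ → ℂ := fun i x => b i * (x : ℂ) ^ (α + 2 * i - 1) with hF
    have hre : ∀ i : ℕ, (α + 2 * (i : ℂ)).re = α.re + 2 * i := fun i => by simp
    have hre0 : ∀ i : ℕ, 0 < (α + 2 * (i : ℂ)).re := fun i => by rw [hre]; positivity
    have hFi : ∀ i, ∫ x in Ioc 0 (1 / 2), F i x
        = b i * ((1 / 2 : ℂ) ^ (α + 2 * i) / (α + 2 * i)) := by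
      intro i
      have hne : α + 2 * (i : ℂ) ≠ 0 := fun h => by
        have := hre0 i; rw [h] at this; simp at this
      simp only [hF]
      rw [integral_const_mul, ← intervalIntegral.integral_of_le (by norm_num),
        integral_cpow (Or.inl (by have := hre0 i; simp at this ⊢; linarith))]
      simp [zero_cpow hne]
    have hsum : Summable fun i => ∫ x in Ioc 0 (1 / 2), ‖F i x‖ := by
      have hn : ∀ i, ∫ x in Ioc 0 (1 / 2), ‖F i x‖
          = ‖b i‖ * ((1 / 2 : ℝ) ^ (α.re + 2 * i) / (α.re + 2 * i)) := by
        intro i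
        have : ∀ x ∈ Ioc (0 : ℝ) (1 / 2), ‖F i x‖ = ‖b i‖ * x ^ (α.re + 2 * i - 1) := by
          intro x hx
          simp only [hF]
          rw [norm_mul, norm_cpow_eq_rpow_re_of_pos hx.1]
          simp
        rw [setIntegral_congr_fun measurableSet_Ioc this, integral_const_mul,
          ← intervalIntegral.integral_of_le (by norm_num),
          integral_rpow (Or.inl (by have := hre0 i; rw [hre] at this; linarith)), sub_add_cancel,
          Real.zero_rpow (by have := hre0 i; rw [hre] at this; exact this.ne'), sub_zero]
      simp_rw [hn]
      refine Summable.of_nonneg_of_le (fun i => by positivity) (fun i => ?_)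
        (((summable_geometric_of_lt_one (r := 3 / 4) (by norm_num) (by norm_num)).mul_left
          (C * ((1 / 2 : ℝ) ^ α.re / α.re))))
      rw [Real.rpow_add (by norm_num), Real.rpow_mul (by norm_num), Real.rpow_natCast]
      calc ‖b i‖ * ((1 / 2 : ℝ) ^ α.re * ((1 / 2 : ℝ) ^ (2 : ℝ)) ^ i / (α.re + 2 * i))
          ≤ (C * 3 ^ i) * ((1 / 2 : ℝ) ^ α.re * ((1 / 2 : ℝ) ^ (2 : ℝ)) ^ i / α.re) := by
            gcongr
            · exact hb i
            · linarith [(i.cast_nonneg : (0 : ℝ) ≤ i)]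
        _ = C * ((1 / 2 : ℝ) ^ α.re / α.re) * (3 / 4) ^ i := by
            rw [show ((1 / 2 : ℝ) ^ (2 : ℝ)) = 1 / 4 by norm_num,
              show (3 / 4 : ℝ) = 3 * (1 / 4) by norm_num, mul_pow]
            ring
    have h := hasSum_integral_of_summable_integral_norm
      (fun i => ((hint _ (hre0 i)).const_mul (b i))) hsum
    rw [finitePart, ← tsum_congr hFi, h.tsum_eq]
    refine setIntegral_congr_fun measurableSet_Ioc fun x hx => ?_
    rw [← tsum_mul_left]
    refine tsum_congr fun i => ?_
    have hx0 : (x : ℂ) ≠ 0 := by exact_mod_cast hx.1.ne'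
    rw [show α + 2 * (i : ℂ) - 1 = (α - 1) + (2 * i : ℕ) by push_cast; ring, cpow_add _ _ hx0,
      cpow_natCast]
    ring

theorem tsum_mul_tsum_eq_tsum_seqConv {a b : ℕ → ℂ} {A B : ℝ} (ha : ∀ i, ‖a i‖ ≤ A * 3 ^ i)
    (hb : ∀ i, ‖b i‖ ≤ B * 3 ^ i) {z : ℂ} (hz : 3 * ‖z‖ ^ 2 < 1) :
    (∑' i, a i * z ^ (2 * i)) * (∑' i, b i * z ^ (2 * i)) = ∑' i, seqConv a b i * z ^ (2 * i) := by
  have h1 := summable_powerSeries ha le_rfl hz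
  have h2 := summable_powerSeries hb le_rfl hz
  rw [tsum_mul_tsum_eq_tsum_sum_antidiagonal_of_summable_norm
    (h1.1.of_nonneg_of_le (fun _ => norm_nonneg _) h1.2)
    (h2.1.of_nonneg_of_le (fun _ => norm_nonneg _) h2.2)]
  refine tsum_congr fun i => ?_
  rw [seqConv, Finset.sum_mul]
  refine Finset.sum_congr rfl fun p hp => ?_
  rw [← Finset.HasAntidiagonal.mem_antidiagonal.1 hp]
  ring

/-! ### Expansion of the periodic zeta function at x = 0 -/

/-- The factor of the functional equation `cosZeta a s = fourierFactor s * hurwitzZetaEven a (1 - s)`. -/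
noncomputable def fourierFactor (s : ℂ) : ℂ :=
  2 * (2 * Real.pi : ℂ) ^ (s - 1) * Gamma (1 - s) * cos (Real.pi * (1 - s) / 2)

/-- The coefficient of `x ^ (2 * i)` in the Taylor expansion of `∑_{m ≠ 0} |m + x| ^ (s - 1)`. -/
noncomputable def latticeCoeff (i : ℕ) (s : ℂ) : ℂ :=
  2 * Ring.choose (s - 1) (2 * i) * riemannZeta (2 * i - (s - 1))

/-- The coefficient of `x ^ (2 * i)` in the regular part of `2 * cosZeta x s` at `x = 0`. -/
noncomputable def cosCoeff (i : ℕ) (s : ℂ) : ℂ :=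
  if i = 0 then 2 * riemannZeta s else fourierFactor s * latticeCoeff i s

/-- The half-plane `Re s < 2` without the pole `s = 1`. -/
def leftRegion : Set ℂ := {s | s.re < 2 ∧ s ≠ 1}

theorem isOpen_leftRegion : IsOpen leftRegion :=
  (isOpen_lt continuous_re continuous_const).inter isOpen_ne

theorem differentiableAt_fourierFactor {s : ℂ} (hs : ∀ n : ℕ, s ≠ n + 1) :
    DifferentiableAt ℂ fourierFactor s := by
  have hΓ : DifferentiableAt ℂ (fun s : ℂ => Gamma (1 - s)) s := by
    refine DifferentiableAt.comp (g := Gamma) s (differentiableAt_Gamma _ fun m h => hs m ?_)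
      (by fun_prop)
    linear_combination -h
  have hp : DifferentiableAt ℂ (fun s : ℂ => (2 * Real.pi : ℂ) ^ (s - 1)) s :=
    DifferentiableAt.const_cpow (by fun_prop) (Or.inl (by simp [Real.pi_ne_zero]))
  exact ((hp.const_mul 2).mul hΓ).mul (by fun_prop)

theorem ne_natCast_add_one_of_mem_leftRegion {s : ℂ} (hs : s ∈ leftRegion) (n : ℕ) :
    s ≠ n + 1 := by
  rintro rfl
  obtain ⟨h1, h2⟩ := hs
  have h3 : n < 1 := by
    have : (n : ℝ) < 1 := by simp at h1; linarith
    exact_mod_cast this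
  obtain rfl : n = 0 := by omega
  simp at h2

theorem exists_norm_riemannZeta_le {σ : ℝ} (hσ : 1 < σ) :
    ∃ Z : ℝ, 0 ≤ Z ∧ ∀ w : ℂ, σ ≤ w.re → ‖riemannZeta w‖ ≤ Z := by
  have hS := summable_norm_succ_cpow (w := -(σ : ℂ)) (by simpa using hσ)
  refine ⟨∑' m : ℕ, ‖((m : ℂ) + 1) ^ (-(σ : ℂ))‖, tsum_nonneg fun _ => norm_nonneg _,
    fun w hw => ?_⟩
  rw [← neg_neg w, ← tsum_succ_cpow (by simp; linarith)]
  refine tsum_of_norm_bounded hS.hasSum fun m => ?_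
  rw [← Nat.cast_succ, norm_natCast_cpow_of_pos m.succ_pos, norm_natCast_cpow_of_pos m.succ_pos]
  exact Real.rpow_le_rpow_of_exponent_le (by simp) (by simpa using hw)

/-- For positive index the zeta argument has real part greater than 1, so its pole is avoided. Index
0 is excluded: there ζ(1 - s) has a pole at s = 0. -/
theorem differentiableAt_latticeCoeff_succ (i : ℕ) {s : ℂ} (hs : s.re < 2) :
    DifferentiableAt ℂ (latticeCoeff (i + 1)) s := by
  have h1 : DifferentiableAt ℂ (fun s : ℂ => Ring.choose (s - 1) (2 * (i + 1))) s :=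
    ((differentiable_ring_choose _).comp (differentiable_id.sub_const 1)) s
  have h2 : DifferentiableAt ℂ (fun s : ℂ => riemannZeta (2 * (i + 1 : ℕ) - (s - 1))) s := by
    refine DifferentiableAt.comp (g := riemannZeta) s (differentiableAt_riemannZeta fun h => ?_)
      (by fun_prop)
    have := congrArg re h
    simp at this
    linarith [(i.cast_nonneg : (0 : ℝ) ≤ i)]
  exact (h1.const_mul 2).mul h2

theorem eventually_norm_latticeCoeff_succ_le {s₀ : ℂ} (hs₀ : s₀.re < 2) :
    ∃ C : ℝ, 0 ≤ C ∧ ∀ᶠ s in 𝓝 s₀, ∀ i, ‖latticeCoeff (i + 1) s‖ ≤ C * 2 ^ (i + 1) := by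
  -- Near s₀ one has `Re s < σ < 2`, so every zeta argument has real part at least 3 - σ > 1 and a
  -- single bound serves all i.
  obtain ⟨σ, h1, h2⟩ := exists_between hs₀
  obtain ⟨Z, hZ, hZb⟩ := exists_norm_riemannZeta_le (σ := 3 - σ) (by linarith)
  obtain ⟨C, hC, hCb⟩ := exists_norm_ring_choose_even_le (‖s₀ - 1‖ + 1)
  refine ⟨2 * C * Z, by positivity, ?_⟩
  have e1 : ∀ᶠ s : ℂ in 𝓝 s₀, s.re < σ := continuous_re.continuousAt.eventually (gt_mem_nhds h1)
  have e2 : ∀ᶠ s : ℂ in 𝓝 s₀, ‖s - 1‖ < ‖s₀ - 1‖ + 1 :=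
    (continuous_id.sub continuous_const).norm.continuousAt.eventually (gt_mem_nhds (lt_add_one _))
  filter_upwards [e1, e2] with s k1 k2 i
  rw [latticeCoeff, norm_mul, norm_mul, Complex.norm_ofNat]
  have h3 := hCb (s - 1) k2.le (i + 1)
  have h4 := hZb (2 * (i + 1 : ℕ) - (s - 1)) (by
    simp; linarith [(i.cast_nonneg : (0 : ℝ) ≤ i)])
  calc 2 * ‖Ring.choose (s - 1) (2 * (i + 1))‖ * ‖riemannZeta (2 * (i + 1 : ℕ) - (s - 1))‖
      ≤ 2 * (C * 2 ^ (i + 1)) * Z := by gcongr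
    _ = _ := by ring

theorem geomBounded_cosCoeff : GeomBounded cosCoeff leftRegion 2 := by
  refine ⟨fun i s hs => DifferentiableAt.differentiableWithinAt ?_, fun s₀ hs₀ => ?_⟩
  · rcases i with _ | i
    · exact ((differentiableAt_riemannZeta hs.2).const_mul 2).congr_of_eventuallyEq
        (Eventually.of_forall fun s => by simp [cosCoeff])
    · exact ((differentiableAt_fourierFactor (ne_natCast_add_one_of_mem_leftRegion hs)).mul
        (differentiableAt_latticeCoeff_succ i hs.1)).congr_of_eventuallyEq
        (Eventually.of_forall fun s => by simp [cosCoeff])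
  · obtain ⟨C, hC, hb⟩ := eventually_norm_latticeCoeff_succ_le hs₀.1
    have e1 : ∀ᶠ s : ℂ in 𝓝 s₀, ‖fourierFactor s‖ < ‖fourierFactor s₀‖ + 1 :=
      (differentiableAt_fourierFactor
        (ne_natCast_add_one_of_mem_leftRegion hs₀)).continuousAt.norm.eventually
        (gt_mem_nhds (lt_add_one _))
    have e2 : ∀ᶠ s : ℂ in 𝓝 s₀, ‖2 * riemannZeta s‖ < ‖2 * riemannZeta s₀‖ + 1 :=
      ((differentiableAt_riemannZeta hs₀.2).const_mul 2).continuousAt.norm.eventually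
        (gt_mem_nhds (lt_add_one _))
    refine ⟨(‖fourierFactor s₀‖ + 1) * C + (‖2 * riemannZeta s₀‖ + 1), by positivity, ?_⟩
    filter_upwards [hb, e1, e2] with s k1 k2 k3 i
    rcases i with _ | i
    · simp only [cosCoeff, if_true, pow_zero, mul_one]
      nlinarith [norm_nonneg (fourierFactor s₀)]
    · simp only [cosCoeff, Nat.succ_ne_zero, if_false]
      rw [norm_mul]
      calc ‖fourierFactor s‖ * ‖latticeCoeff (i + 1) s‖
          ≤ (‖fourierFactor s₀‖ + 1) * (C * 2 ^ (i + 1)) :=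
            mul_le_mul k2.le (k1 i) (norm_nonneg _) (by positivity)
        _ ≤ _ := by
            rw [← mul_assoc]
            gcongr
            rw [le_add_iff_nonneg_right]
            positivity

/-- For `Re s < 0` the left side is the convergent sum of |m + x|^(s-1) over all integers m. The
term m = 0 is split off, and m + 1 + x is paired with m + 1 - x to apply `hasSum_shifted_cpow`. -/
theorem hurwitzZetaEven_one_sub_eq {x : ℝ} (hx : x ∈ Ioc 0 (1 / 2 : ℝ)) {s : ℂ} (hs : s.re < 0) :
    2 * HurwitzZeta.hurwitzZetaEven x (1 - s) =
      (x : ℂ) ^ (s - 1) + ∑' i : ℕ, latticeCoeff i s * (x : ℂ) ^ (2 * i) := by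
  have hx1 : x ∈ Icc (0 : ℝ) 1 := ⟨hx.1.le, by linarith [hx.2]⟩
  have hw : (s - 1).re < -1 := by simp; linarith
  have hz : ‖(x : ℂ)‖ ^ 2 < 1 / 2 := by
    rw [norm_real, Real.norm_of_nonneg hx.1.le]; nlinarith [hx.1, hx.2]
  have hT := (hasSum_shifted_cpow hw hz).1
  have hH := (HurwitzZeta.hasSum_nat_hurwitzZetaEven_of_mem_Icc hx1 (s := 1 - s)
    (by simp; linarith)).mul_left 2
  have hf : Summable fun m : ℕ => ((m : ℂ) + 1 + x) ^ (s - 1) := by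
    refine Summable.of_norm_bounded (summable_norm_succ_cpow hw) fun m => ?_
    have e1 : ((m : ℂ) + 1 + x) = ((m + 1 + x : ℝ) : ℂ) := by push_cast; ring
    have e2 : ((m : ℂ) + 1) = ((m + 1 : ℝ) : ℂ) := by push_cast; ring
    have hm : (0 : ℝ) < m + 1 := by positivity
    rw [e1, e2, norm_cpow_eq_rpow_re_of_pos (by linarith [hx.1]),
      norm_cpow_eq_rpow_re_of_pos hm]
    exact Real.rpow_le_rpow_of_nonpos hm (by linarith [hx.1]) (by linarith)
  have hg := hT.sub hf.hasSum
  have hf0 : HasSum (fun m : ℕ => ((m : ℂ) + x) ^ (s - 1))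
      ((x : ℂ) ^ (s - 1) + ∑' m : ℕ, ((m : ℂ) + 1 + x) ^ (s - 1)) := by
    have := hf.hasSum
    rw [← hasSum_nat_add_iff' 1]
    simpa using this
  have hA := hf0.add hg
  rw [add_add_sub_cancel] at hA
  refine hH.unique (hA.congr_fun fun m => ?_)
  rw [← neg_sub 1 s, cpow_neg, cpow_neg, cpow_neg]
  ring

theorem differentiableOn_tsum_latticeCoeff_succ {x : ℝ} (hx : x ∈ Ioc 0 (1 / 2 : ℝ)) :
    DifferentiableOn ℂ (fun s => ∑' i : ℕ, latticeCoeff (i + 1) s * (x : ℂ) ^ (2 * (i + 1)))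
      {s | s.re < 2} := by
  intro s₀ hs₀
  obtain ⟨C, hC, hb⟩ := eventually_norm_latticeCoeff_succ_le hs₀
  obtain ⟨V, hV, hVo, hVs⟩ := _root_.eventually_nhds_iff.1
    (hb.and ((isOpen_lt continuous_re continuous_const).mem_nhds hs₀))
  refine ((differentiableOn_tsum_of_summable_norm
      (u := fun i : ℕ => C * (1 / 2 : ℝ) ^ (i + 1)) ?_ ?_ hVo ?_).differentiableAt
      (hVo.mem_nhds hVs)).differentiableWithinAt
  · exact ((summable_nat_add_iff 1).2
      (summable_geometric_of_lt_one (by norm_num) (by norm_num))).mul_left _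
  · intro i s hs
    exact ((differentiableAt_latticeCoeff_succ i (hV s hs).2).mul_const _).differentiableWithinAt
  · intro i s hs
    rw [norm_mul, norm_pow, norm_real, Real.norm_of_nonneg hx.1.le, pow_mul]
    calc ‖latticeCoeff (i + 1) s‖ * (x ^ 2) ^ (i + 1)
        ≤ (C * 2 ^ (i + 1)) * ((1 / 2) ^ 2) ^ (i + 1) := by
          have := hx.1.le
          have := hx.2
          have := (hV s hs).1 i
          gcongr
      _ = C * (1 / 2) ^ (i + 1) := by rw [mul_assoc, ← mul_pow]; norm_num

theorem exists_norm_latticeCoeff_le {s : ℂ} (hs : s.re < 2) :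
    ∃ C : ℝ, 0 ≤ C ∧ ∀ i, ‖latticeCoeff i s‖ ≤ C * 2 ^ i := by
  obtain ⟨C, hC, hb⟩ := eventually_norm_latticeCoeff_succ_le hs
  refine ⟨C + ‖latticeCoeff 0 s‖, by positivity, fun i => ?_⟩
  rcases i with _ | i
  · simp [hC]
  · refine (hb.self_of_nhds i).trans ?_
    gcongr
    exact le_add_of_nonneg_right (norm_nonneg (latticeCoeff 0 s))

theorem norm_le_mul_three_pow {a : ℕ → ℂ} {C : ℝ} (ha : ∀ i, ‖a i‖ ≤ C * 2 ^ i) (i : ℕ) :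
    ‖a i‖ ≤ C * 3 ^ i := by
  have hC : 0 ≤ C := by simpa using (norm_nonneg _).trans (ha 0)
  refine (ha i).trans ?_
  gcongr; norm_num

theorem summable_latticeCoeff_mul_pow {s : ℂ} (hs : s.re < 2) {z : ℂ} (hz : 3 * ‖z‖ ^ 2 < 1) :
    Summable fun i => latticeCoeff i s * z ^ (2 * i) := by
  obtain ⟨C, hC, hb⟩ := exists_norm_latticeCoeff_le hs
  have h := summable_powerSeries (norm_le_mul_three_pow hb) le_rfl hz
  exact Summable.of_norm_bounded h.1 h.2

theorem three_mul_sq_norm_lt_one {x : ℝ} (hx : x ∈ Ioc 0 (1 / 2 : ℝ)) :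
    3 * ‖(x : ℂ)‖ ^ 2 < 1 := by
  rw [norm_real, Real.norm_of_nonneg hx.1.le]; nlinarith [hx.1, hx.2]

/-- Subtracting ζ(1 - s), twice of which is the coefficient of index 0, removes the pole at s = 0.
Both sides are then analytic on the whole half-plane, and the identity theorem extends the equality
from a neighbourhood of -1. -/
theorem hurwitzZetaEven_sub_zeta_eq {x : ℝ} (hx : x ∈ Ioc 0 (1 / 2 : ℝ)) {s : ℂ} (hs : s.re < 2) :
    2 * (HurwitzZeta.hurwitzZetaEven x (1 - s) - riemannZeta (1 - s)) =
      (x : ℂ) ^ (s - 1) + ∑' i : ℕ, latticeCoeff (i + 1) s * (x : ℂ) ^ (2 * (i + 1)) := by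
  have hU : IsOpen {s : ℂ | s.re < 2} := isOpen_lt continuous_re continuous_const
  have hx0 : (x : ℂ) ≠ 0 := by exact_mod_cast hx.1.ne'
  have hL : AnalyticOnNhd ℂ (fun s : ℂ =>
      2 * (HurwitzZeta.hurwitzZetaEven x (1 - s) - riemannZeta (1 - s))) {s | s.re < 2} := by
    refine DifferentiableOn.analyticOnNhd (Differentiable.differentiableOn ?_) hU
    have := (HurwitzZeta.differentiable_hurwitzZetaEven_sub_hurwitzZetaEven x 0)
    rw [HurwitzZeta.hurwitzZetaEven_zero] at this
    exact (this.comp (differentiable_id.const_sub 1)).const_mul 2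
  have hR : AnalyticOnNhd ℂ (fun s : ℂ => (x : ℂ) ^ (s - 1) +
      ∑' i : ℕ, latticeCoeff (i + 1) s * (x : ℂ) ^ (2 * (i + 1))) {s | s.re < 2} := by
    refine DifferentiableOn.analyticOnNhd (DifferentiableOn.add (fun s _ => ?_)
      (differentiableOn_tsum_latticeCoeff_succ hx)) hU
    exact (DifferentiableAt.const_cpow (by fun_prop) (Or.inl hx0)).differentiableWithinAt
  refine hL.eqOn_of_preconnected_of_eventuallyEq hR
    (convex_halfSpace_re_lt 2).isPreconnected (z₀ := -1) (by simp; norm_num) ?_ hs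
  have e : ∀ᶠ s : ℂ in 𝓝 (-1), s.re < 0 :=
    continuous_re.continuousAt.eventually (gt_mem_nhds (by simp))
  filter_upwards [e] with s hs'
  have h := hurwitzZetaEven_one_sub_eq hx hs'
  rw [(summable_latticeCoeff_mul_pow (by linarith) (three_mul_sq_norm_lt_one hx)).tsum_eq_zero_add]
    at h
  have h0 : latticeCoeff 0 s = 2 * riemannZeta (1 - s) := by simp [latticeCoeff]
  rw [h0] at h
  simp only [mul_zero, pow_zero, mul_one] at h
  linear_combination h

theorem riemannZeta_eq_fourierFactor_mul {s : ℂ} (hs : ∀ n : ℕ, s ≠ n + 1) (hs0 : s ≠ 0) :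
    riemannZeta s = fourierFactor s * riemannZeta (1 - s) := by
  have h := riemannZeta_one_sub (s := 1 - s) (fun n h => hs n (by linear_combination -h))
    (fun h => hs0 (by linear_combination -h))
  rw [sub_sub_cancel, neg_sub] at h
  exact h

/-- For i = 0 this is the functional equation of ζ. `cosCoeff` uses 2ζ(s) there since it stays
holomorphic at s = 0, where the product on the right involves a pole. -/
theorem cosCoeff_eq {s : ℂ} (hs : ∀ n : ℕ, s ≠ n + 1) (hs0 : s ≠ 0) (i : ℕ) :
    cosCoeff i s = fourierFactor s * latticeCoeff i s := by
  rcases i with _ | i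
  · simp [cosCoeff, latticeCoeff]
    rw [riemannZeta_eq_fourierFactor_mul hs hs0]; ring
  · simp [cosCoeff]

/-- The expansion of the periodic zeta function at the singularity `x = 0`. -/
theorem two_mul_cosZeta_eq {x : ℝ} (hx : x ∈ Ioc 0 (1 / 2 : ℝ)) {s : ℂ} (hs : s.re < 2)
    (hs' : ∀ n : ℕ, s ≠ n) :
    2 * HurwitzZeta.cosZeta x s = fourierFactor s * (x : ℂ) ^ (s - 1) +
      ∑' i : ℕ, cosCoeff i s * (x : ℂ) ^ (2 * i) := by
  have h1 := HurwitzZeta.cosZeta_one_sub (x : UnitAddCircle) (s := 1 - s)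
    (fun n h => hs' n (by linear_combination -h))
  rw [sub_sub_cancel, neg_sub] at h1
  have h2 := hurwitzZetaEven_sub_zeta_eq hx hs
  have hsum := summable_latticeCoeff_mul_pow hs (three_mul_sq_norm_lt_one hx)
  have h0 : latticeCoeff 0 s = 2 * riemannZeta (1 - s) := by simp [latticeCoeff]
  have h3 := hsum.tsum_eq_zero_add
  rw [h0] at h3
  simp only [mul_zero, pow_zero, mul_one] at h3
  have h4 : ∀ i, cosCoeff i s * (x : ℂ) ^ (2 * i) =
      fourierFactor s * (latticeCoeff i s * (x : ℂ) ^ (2 * i)) := fun i => by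
    rw [cosCoeff_eq (fun n => by exact_mod_cast hs' (n + 1)) (by simpa using hs' 0), mul_assoc]
  rw [tsum_congr h4, tsum_mul_left, h3, h1, fourierFactor]
  linear_combination (2 * (2 * Real.pi : ℂ) ^ (s - 1) * Gamma (1 - s)
    * cos (Real.pi * (1 - s) / 2)) * h2

/-! ### Orthogonality and the integral of the cube -/

/-- The Fourier series with coefficients `c` on the positive (`ε = 1`) or negative (`ε = -1`)
frequencies. -/
noncomputable def halfFourierSeries (c : ℕ+ → ℂ) (ε : ℤ) (x : ℝ) : ℂ :=
  ∑' a : ℕ+, c a * cexp (2 * Real.pi * I * ((ε * a : ℤ) : ℂ) * x)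

theorem summable_norm_pnat_cpow {s : ℂ} (hs : 1 < s.re) :
    Summable fun a : ℕ+ => ‖1 / (a : ℂ) ^ s‖ :=
  (summable_one_div_nat_cpow.2 hs).norm.comp_injective PNat.coe_injective

theorem norm_cexp_two_pi_I_int_mul (n : ℤ) (x : ℝ) :
    ‖cexp (2 * Real.pi * I * (n : ℂ) * x)‖ = 1 := by
  have : (2 * Real.pi * I * (n : ℂ) * x) = ((2 * Real.pi * n * x : ℝ) : ℂ) * I := by
    push_cast; ring
  rw [this, norm_exp_ofReal_mul_I]

theorem integral_cexp_two_pi_I_int_mul (n : ℤ) :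
    ∫ x : ℝ in Ioc 0 1, cexp (2 * Real.pi * I * (n : ℂ) * x) = if n = 0 then 1 else 0 := by
  rw [← intervalIntegral.integral_of_le zero_le_one]
  split_ifs with h
  · simp [h]
  · have hc : (2 * Real.pi * I * (n : ℂ)) ≠ 0 := by
      simp [Real.pi_ne_zero, h]
    rw [integral_exp_mul_complex hc]
    have : cexp (2 * Real.pi * I * (n : ℂ) * (1 : ℝ)) = 1 := by
      rw [show (2 * Real.pi * I * (n : ℂ) * (1 : ℝ)) = n * (2 * Real.pi * I) by push_cast; ring]
      exact exp_int_mul_two_pi_mul_I n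
    rw [this]; simp

theorem continuous_halfFourierSeries {c : ℕ+ → ℂ} (hc : Summable fun a => ‖c a‖) (ε : ℤ) :
    Continuous (halfFourierSeries c ε) := by
  refine continuous_tsum (fun a => by fun_prop) hc fun a x => ?_
  rw [norm_mul, norm_cexp_two_pi_I_int_mul, mul_one]

/-- Absolute summability allows expanding the product and integrating term by term; only triples of
total frequency 0 survive. -/
theorem integral_halfFourierSeries_mul_mul {c : ℕ+ → ℂ} (hc : Summable fun a => ‖c a‖) (ε₁ ε₂ ε₃ : ℤ) :
    ∫ x in Ioc (0 : ℝ) 1,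
        halfFourierSeries c ε₁ x * (halfFourierSeries c ε₂ x * halfFourierSeries c ε₃ x) =
      ∑' p : ℕ+ × ℕ+ × ℕ+,
        if ε₁ * p.1 + (ε₂ * p.2.1 + ε₃ * p.2.2) = 0 then
          c p.1 * (c p.2.1 * c p.2.2) else 0 := by
  set F : ℕ+ × ℕ+ × ℕ+ → ℝ → ℂ := fun p x => c p.1 * (c p.2.1 * c p.2.2) *
    cexp (2 * Real.pi * I * ((ε₁ * p.1 + (ε₂ * p.2.1 + ε₃ * p.2.2) : ℤ) : ℂ) * x) with hF
  have hprod : ∀ x, halfFourierSeries c ε₁ x * (halfFourierSeries c ε₂ x * halfFourierSeries c ε₃ x)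
      = ∑' p, F p x := by
    intro x
    have hterm : ∀ ε : ℤ, Summable fun a : ℕ+ =>
        ‖c a * cexp (2 * Real.pi * I * ((ε * a : ℤ) : ℂ) * x)‖ := fun ε =>
      hc.congr fun a => by rw [norm_mul, norm_cexp_two_pi_I_int_mul, mul_one]
    rw [halfFourierSeries, halfFourierSeries, halfFourierSeries,
      tsum_mul_tsum_of_summable_norm (hterm ε₂) (hterm ε₃),
      tsum_mul_tsum_of_summable_norm (hterm ε₁) ((hterm ε₂).mul_norm (hterm ε₃))]
    refine tsum_congr fun p => ?_
    simp only [hF]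
    rw [show 2 * Real.pi * I * ((ε₁ * p.1 + (ε₂ * p.2.1 + ε₃ * p.2.2) : ℤ) : ℂ) * x =
      2 * Real.pi * I * ((ε₁ * p.1 : ℤ) : ℂ) * x + (2 * Real.pi * I * ((ε₂ * p.2.1 : ℤ) : ℂ) * x
        + 2 * Real.pi * I * ((ε₃ * p.2.2 : ℤ) : ℂ) * x) by push_cast; ring, Complex.exp_add,
      Complex.exp_add]
    ring
  have hnorm : ∀ p x, ‖F p x‖ = ‖c p.1 * (c p.2.1 * c p.2.2)‖ := fun p x => by
    simp only [hF]
    rw [norm_mul, norm_cexp_two_pi_I_int_mul, mul_one]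
  have hint : ∀ p, IntegrableOn (F p) (Ioc 0 1) := fun p =>
    (Continuous.integrableOn_Icc (by simp only [hF]; fun_prop)).mono_set Ioc_subset_Icc_self
  have hsum : Summable fun p => ∫ x in Ioc (0 : ℝ) 1, ‖F p x‖ := by
    simp_rw [hnorm]
    simpa using hc.mul_norm (hc.mul_norm hc)
  rw [setIntegral_congr_fun measurableSet_Ioc fun x _ => hprod x,
    ← (hasSum_integral_of_summable_integral_norm hint hsum).tsum_eq]
  refine tsum_congr fun p => ?_
  simp only [hF]
  rw [integral_const_mul, integral_cexp_two_pi_I_int_mul]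
  simp

theorem su3WittenTerm_eq (s : ℂ) (p : ℕ+ × ℕ+) :
    su3WittenTerm s p = 1 / (p.1 : ℂ) ^ s * (1 / (p.2 : ℂ) ^ s * (1 / ((p.1 + p.2 : ℕ+) : ℂ) ^ s)) := by
  have h : ((p.1 : ℂ) * (p.2 : ℂ) * ((p.1 : ℂ) + (p.2 : ℂ))) ^ s =
      (p.1 : ℂ) ^ s * (p.2 : ℂ) ^ s * ((p.1 + p.2 : ℕ+) : ℂ) ^ s := by
    rw [← natCast_mul_natCast_cpow, PNat.add_coe, Nat.cast_add, ← Nat.cast_mul, ← Nat.cast_add,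
      natCast_mul_natCast_cpow]
  rw [su3WittenTerm, h]
  simp only [one_div, mul_inv]
  ring

theorem tsum_ite_add_eq {f : ℕ+ × ℕ+ × ℕ+ → ℂ} {q : ℕ+ × ℕ+ × ℕ+ → Prop} [DecidablePred q]
    (hq : ∀ p, q p ↔ p.2.2 = p.1 + p.2.1) :
    ∑' p, (if q p then f p else 0) = ∑' p : ℕ+ × ℕ+, f (p.1, p.2, p.1 + p.2) := by
  set g : ℕ+ × ℕ+ → ℕ+ × ℕ+ × ℕ+ := fun p => (p.1, p.2, p.1 + p.2) with hg
  have hinj : Function.Injective g := by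
    rintro ⟨a, b⟩ ⟨c, d⟩ h
    simp only [hg, Prod.mk.injEq] at h
    rw [h.1, h.2.1]
  rw [← hinj.tsum_eq]
  · exact tsum_congr fun p => if_pos ((hq _).2 rfl)
  · intro p hp
    rw [Function.mem_support] at hp
    have h : q p := by
      by_contra h; exact hp (if_neg h)
    exact ⟨(p.1, p.2.1), Prod.ext rfl (Prod.ext rfl ((hq p).1 h).symm)⟩

theorem integral_halfFourierSeries_same {c : ℕ+ → ℂ} (hc : Summable fun a => ‖c a‖) {ε : ℤ} (hε : ε ≠ 0) :
    ∫ x in Ioc (0 : ℝ) 1,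
      halfFourierSeries c ε x * (halfFourierSeries c ε x * halfFourierSeries c ε x) = 0 := by
  rw [integral_halfFourierSeries_mul_mul hc]
  rw [tsum_congr (g := fun _ => 0), tsum_zero]
  intro p
  refine if_neg fun h => ?_
  rw [← mul_add, ← mul_add, mul_eq_zero] at h
  have := p.1.pos
  rcases h with h | h
  · exact hε h
  · omega

theorem integral_halfFourierSeries_mixed {c : ℕ+ → ℂ} (hc : Summable fun a => ‖c a‖) {ε : ℤ} (hε : ε ≠ 0) :
    ∫ x in Ioc (0 : ℝ) 1,
      halfFourierSeries c ε x * (halfFourierSeries c ε x * halfFourierSeries c (-ε) x) =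
      ∑' p : ℕ+ × ℕ+, c p.1 * (c p.2 * c (p.1 + p.2)) := by
  rw [integral_halfFourierSeries_mul_mul hc, tsum_ite_add_eq]
  · intro p
    rw [show ε * p.1 + (ε * p.2.1 + -ε * p.2.2) = ε * ((p.1 : ℤ) + p.2.1 - p.2.2) by ring,
      mul_eq_zero, or_iff_right hε, ← PNat.coe_inj, PNat.add_coe]
    omega

theorem two_mul_cosZeta_eq_add {s : ℂ} (hs : 1 < s.re) (x : ℝ) :
    2 * HurwitzZeta.cosZeta x s = halfFourierSeries (fun a => 1 / (a : ℂ) ^ s) 1 x + halfFourierSeries (fun a => 1 / (a : ℂ) ^ s) (-1) x := by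
  have hc := summable_norm_pnat_cpow hs
  have hterm : ∀ ε : ℤ, Summable fun a : ℕ+ =>
      1 / (a : ℂ) ^ s * cexp (2 * Real.pi * I * ((ε * a : ℤ) : ℂ) * x) := fun ε =>
    Summable.of_norm (hc.congr fun a => by rw [norm_mul, norm_cexp_two_pi_I_int_mul, mul_one])
  have h := (HurwitzZeta.hasSum_nat_cosZeta x hs).mul_left 2
  have hinj := PNat.coe_injective
  rw [← hinj.hasSum_iff] at h
  · rw [halfFourierSeries, halfFourierSeries, ← (hterm 1).tsum_add (hterm (-1)), ← h.tsum_eq]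
    refine tsum_congr fun a => ?_
    simp only [Function.comp]
    push_cast
    rw [Complex.cos]
    rw [show 2 * (Real.pi : ℂ) * x * a * I = 2 * Real.pi * I * (1 * a) * x by ring,
      show -(2 * (Real.pi : ℂ) * x * a) * I = 2 * Real.pi * I * (-1 * a) * x by ring]
    ring
  · intro n hn
    have : n = 0 := by
      by_contra h0
      exact hn ⟨⟨n, Nat.pos_of_ne_zero h0⟩, rfl⟩
    subst this
    have hs0 : s ≠ 0 := fun h => by rw [h] at hs; simp at hs; linarith
    simp [zero_cpow hs0]

theorem continuous_cosZeta {s : ℂ} (hs : 1 < s.re) :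
    Continuous fun x : ℝ => HurwitzZeta.cosZeta x s := by
  have : (fun x : ℝ => HurwitzZeta.cosZeta x s) = fun x : ℝ =>
      (halfFourierSeries (fun a => 1 / (a : ℂ) ^ s) 1 x + halfFourierSeries (fun a => 1 / (a : ℂ) ^ s) (-1) x) / 2 := by
    ext x; rw [← two_mul_cosZeta_eq_add hs]; ring
  rw [this]
  have h1 := continuous_halfFourierSeries (summable_norm_pnat_cpow hs) 1
  have h2 := continuous_halfFourierSeries (summable_norm_pnat_cpow hs) (-1)
  fun_prop

theorem integral_cosZeta_cube_zero_one {s : ℂ} (hs : 1 < s.re) :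
    ∫ x in Ioc (0 : ℝ) 1, (2 * HurwitzZeta.cosZeta x s) ^ 3 = 6 * ∑' p, su3WittenTerm s p := by
  have hc := summable_norm_pnat_cpow hs
  simp_rw [su3WittenTerm_eq]
  have hcont := fun ε => continuous_halfFourierSeries (summable_norm_pnat_cpow hs) ε
  have hint : ∀ ε₁ ε₂ ε₃ : ℤ, IntegrableOn (fun x => halfFourierSeries (fun a => 1 / (a : ℂ) ^ s) ε₁ x *
      (halfFourierSeries (fun a => 1 / (a : ℂ) ^ s) ε₂ x * halfFourierSeries (fun a => 1 / (a : ℂ) ^ s) ε₃ x)) (Ioc 0 1) := fun ε₁ ε₂ ε₃ =>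
    (((hcont ε₁).mul ((hcont ε₂).mul (hcont ε₃))).integrableOn_Icc).mono_set Ioc_subset_Icc_self
  -- With A and B the half series, (A + B)³ is grouped as (A³ + 3A²B) + (B³ + 3B²A). The cubes
  -- integrate to 0 and each mixed product to ω(s). The sign `- -1` matches the mixed integral at ε
  -- = -1.
  have he : ∀ x : ℝ, (2 * HurwitzZeta.cosZeta x s) ^ 3 =
      (halfFourierSeries (fun a => 1 / (a : ℂ) ^ s) 1 x * (halfFourierSeries (fun a => 1 / (a : ℂ) ^ s) 1 x * halfFourierSeries (fun a => 1 / (a : ℂ) ^ s) 1 x) +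
        3 * (halfFourierSeries (fun a => 1 / (a : ℂ) ^ s) 1 x * (halfFourierSeries (fun a => 1 / (a : ℂ) ^ s) 1 x * halfFourierSeries (fun a => 1 / (a : ℂ) ^ s) (-1) x))) +
      (halfFourierSeries (fun a => 1 / (a : ℂ) ^ s) (-1) x * (halfFourierSeries (fun a => 1 / (a : ℂ) ^ s) (-1) x * halfFourierSeries (fun a => 1 / (a : ℂ) ^ s) (-1) x) +
        3 * (halfFourierSeries (fun a => 1 / (a : ℂ) ^ s) (-1) x * (halfFourierSeries (fun a => 1 / (a : ℂ) ^ s) (-1) x *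
          halfFourierSeries (fun a => 1 / (a : ℂ) ^ s) (- -1) x))) := fun x => by
    rw [two_mul_cosZeta_eq_add hs, neg_neg]; ring
  simp_rw [he]
  have hint' : ∀ ε : ℤ, IntegrableOn (fun x => halfFourierSeries (fun a => 1 / (a : ℂ) ^ s) ε x *
      (halfFourierSeries (fun a => 1 / (a : ℂ) ^ s) ε x * halfFourierSeries (fun a => 1 / (a : ℂ) ^ s) ε x) + 3 * (halfFourierSeries (fun a => 1 / (a : ℂ) ^ s) ε x *
        (halfFourierSeries (fun a => 1 / (a : ℂ) ^ s) ε x * halfFourierSeries (fun a => 1 / (a : ℂ) ^ s) (-ε) x))) (Ioc 0 1) := fun ε =>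
    (hint _ _ _).add ((hint _ _ _).const_mul 3)
  rw [integral_add (hint' 1) (hint' (-1)), integral_add (hint _ _ _)
    ((hint _ _ _).const_mul 3), integral_add (hint _ _ _) ((hint _ _ _).const_mul 3),
    integral_const_mul, integral_const_mul, integral_halfFourierSeries_same hc one_ne_zero,
    integral_halfFourierSeries_same hc (by norm_num), integral_halfFourierSeries_mixed hc one_ne_zero,
    integral_halfFourierSeries_mixed hc (by norm_num)]
  ring

theorem integral_cosZeta_cube {s : ℂ} (hs : 1 < s.re) :
    ∫ x in Ioc (0 : ℝ) (1 / 2), (2 * HurwitzZeta.cosZeta x s) ^ 3 =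
      3 * ∑' p, su3WittenTerm s p := by
  have h := integral_cosZeta_cube_zero_one hs
  set F : ℝ → ℂ := fun x => (2 * HurwitzZeta.cosZeta x s) ^ 3 with hF
  have hFc : Continuous F := by
    have := continuous_cosZeta hs
    simp only [hF]; fun_prop
  have hsymm : ∀ x : ℝ, F (1 - x) = F x := fun x => by
    have : (((1 - x : ℝ)) : UnitAddCircle) = -(x : UnitAddCircle) := by
      rw [AddCircle.coe_sub, AddCircle.coe_period, zero_sub]
    simp only [hF]
    rw [this, HurwitzZeta.cosZeta_neg]
  rw [← intervalIntegral.integral_of_le zero_le_one,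
    ← intervalIntegral.integral_add_adjacent_intervals (b := 1 / 2)
      (hFc.intervalIntegrable _ _) (hFc.intervalIntegrable _ _)] at h
  have h2 : ∫ x in (1 / 2 : ℝ)..1, F x = ∫ x in (0 : ℝ)..1 / 2, F x := by
    have := intervalIntegral.integral_comp_sub_left F (a := 0) (b := 1 / 2) 1
    simp_rw [hsymm] at this
    rw [this]; norm_num
  rw [h2] at h
  rw [← intervalIntegral.integral_of_le (by norm_num)]
  linear_combination h / 2

/-! ### The continuation formula -/

/-- The finite part of `∫ (fourierFactor s * x ^ (s - 1) + ∑ cosCoeff i s * x ^ (2 * i)) ^ 3` over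
`[0, 1 / 2]`. -/
noncomputable def cubeFinitePart (s : ℂ) : ℂ :=
  fourierFactor s ^ 3 * ((1 / 2 : ℂ) ^ (3 * s - 2) / (3 * s - 2)) +
    3 * (fourierFactor s ^ 2 * finitePart (cosCoeff · s) (2 * s - 1)) +
    3 * (fourierFactor s * finitePart (fun i => seqConv (cosCoeff · s) (cosCoeff · s) i) s) +
    finitePart (fun i => seqConv (cosCoeff · s) (seqConv (cosCoeff · s) (cosCoeff · s)) i) 1

theorem exists_norm_cosCoeff_le {s : ℂ} (hs : s ∈ leftRegion) :
    ∃ C : ℝ, 0 ≤ C ∧ ∀ i, ‖cosCoeff i s‖ ≤ C * 2 ^ i := by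
  obtain ⟨C, hC, h⟩ := geomBounded_cosCoeff.bound s hs
  exact ⟨C, hC, h.self_of_nhds⟩

theorem ne_natCast_of_re_mem_Ioo {s : ℂ} (h1 : 1 < s.re) (h2 : s.re < 2) (n : ℕ) : s ≠ n := by
  rintro rfl
  rw [natCast_re] at h1 h2
  have h3 : 1 < n := by exact_mod_cast h1
  have h4 : n < 2 := by exact_mod_cast h2
  omega

/-- In this strip the Fourier series converges absolutely, the expansion at x = 0 holds, and 3s - 2,
2s - 1, s and 1 have positive real part. Every finite part is therefore an honest integral. -/
theorem three_mul_tsum_su3WittenTerm {s : ℂ} (h1 : 1 < s.re) (h2 : s.re < 2) :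
    3 * ∑' p, su3WittenTerm s p = cubeFinitePart s := by
  have hne := ne_natCast_of_re_mem_Ioo h1 h2
  have hs : s ∈ leftRegion := ⟨h2, by simpa using hne 1⟩
  obtain ⟨C, hC, ha2⟩ := exists_norm_cosCoeff_le hs
  have ha := norm_le_mul_three_pow ha2
  have haa := norm_seqConv_le hC ha2 ha
  have haaa := norm_seqConv_le hC ha2 haa
  set G := fourierFactor s
  set a : ℕ → ℂ := (cosCoeff · s)
  have i1 : IntegrableOn (fun x : ℝ => (x : ℂ) ^ (3 * s - 2 - 1)) (Ioc 0 (1 / 2)) :=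
    (intervalIntegrable_iff_integrableOn_Ioc_of_le (by norm_num)).1
      (intervalIntegral.intervalIntegrable_cpow' (by simp; linarith))
  have v1 : ∫ x : ℝ in Ioc 0 (1 / 2), (x : ℂ) ^ (3 * s - 2 - 1) =
      (1 / 2 : ℂ) ^ (3 * s - 2) / (3 * s - 2) := by
    have h0 : 3 * s - 2 ≠ 0 := fun h => by
      have := congrArg re h
      simp at this; linarith
    rw [← intervalIntegral.integral_of_le (by norm_num),
      integral_cpow (Or.inl (by simp; linarith))]
    simp [zero_cpow h0]
  obtain ⟨i2, v2⟩ := integral_powerSeries ha (α := 2 * s - 1) (by simp; linarith)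
  obtain ⟨i3, v3⟩ := integral_powerSeries haa (α := s) (by linarith)
  obtain ⟨i4, v4⟩ := integral_powerSeries haaa (α := 1) (by simp)
  have hx : ∀ x ∈ Ioc (0 : ℝ) (1 / 2), (2 * HurwitzZeta.cosZeta x s) ^ 3 =
      G ^ 3 * (x : ℂ) ^ (3 * s - 2 - 1) +
      3 * G ^ 2 * ((x : ℂ) ^ (2 * s - 1 - 1) * ∑' i, a i * (x : ℂ) ^ (2 * i)) +
      3 * G * ((x : ℂ) ^ (s - 1) * ∑' i, seqConv a a i * (x : ℂ) ^ (2 * i)) +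
      (x : ℂ) ^ ((1 : ℂ) - 1) * ∑' i, seqConv a (seqConv a a) i * (x : ℂ) ^ (2 * i) := by
    intro x hx
    have hz := three_mul_sq_norm_lt_one hx
    rw [two_mul_cosZeta_eq hx h2 hne, ← tsum_mul_tsum_eq_tsum_seqConv ha haa hz,
      ← tsum_mul_tsum_eq_tsum_seqConv ha ha hz, sub_self, cpow_zero,
      show 3 * s - 2 - 1 = (3 : ℕ) * (s - 1) by push_cast; ring,
      show 2 * s - 1 - 1 = (2 : ℕ) * (s - 1) by push_cast; ring, cpow_nat_mul, cpow_nat_mul]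
    ring
  have I1 : IntegrableOn (fun x : ℝ => G ^ 3 * (x : ℂ) ^ (3 * s - 2 - 1)) (Ioc 0 (1 / 2)) :=
    i1.const_mul _
  have I2 := i2.const_mul (3 * G ^ 2)
  have I3 := i3.const_mul (3 * G)
  have I12 : IntegrableOn (fun x : ℝ => G ^ 3 * (x : ℂ) ^ (3 * s - 2 - 1) +
    3 * G ^ 2 * ((x : ℂ) ^ (2 * s - 1 - 1) * ∑' i, a i * (x : ℂ) ^ (2 * i))) (Ioc 0 (1 / 2)) :=
    I1.add I2
  have I123 : IntegrableOn (fun x : ℝ => G ^ 3 * (x : ℂ) ^ (3 * s - 2 - 1) +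
      3 * G ^ 2 * ((x : ℂ) ^ (2 * s - 1 - 1) * ∑' i, a i * (x : ℂ) ^ (2 * i)) +
      3 * G * ((x : ℂ) ^ (s - 1) * ∑' i, seqConv a a i * (x : ℂ) ^ (2 * i))) (Ioc 0 (1 / 2)) :=
    I12.add I3
  rw [← integral_cosZeta_cube h1, setIntegral_congr_fun measurableSet_Ioc hx,
    integral_add I123 i4, integral_add I12 I3, integral_add I1 I2, integral_const_mul,
    integral_const_mul, integral_const_mul, v1, v2, v3, v4, cubeFinitePart]
  ring

theorem geomBounded_cosCoeff_sq :
    GeomBounded (fun i s => seqConv (cosCoeff · s) (cosCoeff · s) i) leftRegion 3 :=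
  geomBounded_cosCoeff.conv geomBounded_cosCoeff.mono_two_three

theorem geomBounded_cosCoeff_cube :
    GeomBounded (fun i s => seqConv (cosCoeff · s) (seqConv (cosCoeff · s) (cosCoeff · s)) i)
      leftRegion 3 :=
  geomBounded_cosCoeff.conv geomBounded_cosCoeff_sq

theorem analyticAt_fourierFactor {s : ℂ} (hs : s ∈ leftRegion) : AnalyticAt ℂ fourierFactor s :=
  DifferentiableOn.analyticAt (s := leftRegion) (fun _ hw => (differentiableAt_fourierFactor
    (ne_natCast_add_one_of_mem_leftRegion hw)).differentiableWithinAt)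
    (isOpen_leftRegion.mem_nhds hs)

theorem analyticAt_half_cpow_div {s : ℂ} (hs : 3 * s - 2 ≠ 0) :
    AnalyticAt ℂ (fun s : ℂ => (1 / 2 : ℂ) ^ (3 * s - 2) / (3 * s - 2)) s := by
  have h0 : Differentiable ℂ fun s : ℂ => 3 * s - 2 := by fun_prop
  exact (Differentiable.analyticAt (fun s => (h0 s).const_cpow (Or.inl (by norm_num))) s).div
    (h0.analyticAt s) hs

theorem analyticAt_finitePart_cosCoeff {s : ℂ} (hs : s ∈ leftRegion)
    (h : ∀ i : ℕ, 2 * s - 1 + 2 * i ≠ 0) :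
    AnalyticAt ℂ (fun s => finitePart (cosCoeff · s) (2 * s - 1)) s :=
  analyticAt_finitePart (α := fun s => 2 * s - 1) isOpen_leftRegion
    geomBounded_cosCoeff.mono_two_three (by fun_prop) hs h

theorem analyticAt_finitePart_cosCoeff_cube {s : ℂ} (hs : s ∈ leftRegion) :
    AnalyticAt ℂ (fun s => finitePart (fun i =>
      seqConv (cosCoeff · s) (seqConv (cosCoeff · s) (cosCoeff · s)) i) 1) s := by
  refine analyticAt_finitePart (α := fun _ => 1) isOpen_leftRegion
    geomBounded_cosCoeff_cube (by fun_prop) hs fun i h => ?_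
  have : (1 + 2 * i : ℕ) = 0 := by exact_mod_cast h
  omega

theorem analyticAt_cubeFinitePart {s : ℂ} (hs : s ∈ leftRegion) (h1 : 3 * s - 2 ≠ 0)
    (h2 : ∀ i : ℕ, 2 * s - 1 + 2 * i ≠ 0) (h3 : ∀ i : ℕ, s + 2 * i ≠ 0) :
    AnalyticAt ℂ cubeFinitePart s := by
  have hG := analyticAt_fourierFactor hs
  have t3 := analyticAt_finitePart (α := fun s => s) isOpen_leftRegion
    geomBounded_cosCoeff_sq (by fun_prop) hs h3
  exact ((((hG.pow 3).mul (analyticAt_half_cpow_div h1)).add (analyticAt_const.mul ((hG.pow 2).mul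
    (analyticAt_finitePart_cosCoeff hs h2)))).add (analyticAt_const.mul (hG.mul t3))).add
    (analyticAt_finitePart_cosCoeff_cube hs)

theorem meromorphicAt_cubeFinitePart {s : ℂ} (hs : s ∈ leftRegion) :
    MeromorphicAt cubeFinitePart s := by
  have hG := (analyticAt_fourierFactor hs).meromorphicAt
  have h0 : Differentiable ℂ fun s : ℂ => 3 * s - 2 := by fun_prop
  have t1 : MeromorphicAt (fun s : ℂ => (1 / 2 : ℂ) ^ (3 * s - 2) / (3 * s - 2)) s :=
    (Differentiable.analyticAt (fun s => (h0 s).const_cpow (Or.inl (by norm_num)))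
      s).meromorphicAt.div (h0.analyticAt s).meromorphicAt
  have t2 := meromorphicAt_finitePart (α := fun s => 2 * s - 1) isOpen_leftRegion
    geomBounded_cosCoeff.mono_two_three (by fun_prop) hs
  have t3 := meromorphicAt_finitePart (α := fun s => s) isOpen_leftRegion
    geomBounded_cosCoeff_sq (by fun_prop) hs
  have c3 : MeromorphicAt (fun _ : ℂ => (3 : ℂ)) s := analyticAt_const.meromorphicAt
  exact ((((hG.pow 3).mul t1).add (c3.mul ((hG.pow 2).mul t2))).add (c3.mul (hG.mul t3))).add
    (analyticAt_finitePart_cosCoeff_cube hs).meromorphicAt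

/-! ### Absolute convergence of the double series -/

theorem norm_su3WittenTerm_le {σ : ℝ} (hσ : 0 ≤ σ) {s : ℂ} (hs : σ ≤ s.re) (p : ℕ+ × ℕ+) :
    ‖su3WittenTerm s p‖ ≤ ((p.1 : ℕ) : ℝ) ^ (-(3 / 2 * σ)) * ((p.2 : ℕ) : ℝ) ^ (-(3 / 2 * σ)) := by
  obtain ⟨a, b⟩ := p
  have ha : (1 : ℝ) ≤ (a : ℕ) := by exact_mod_cast one_le (a := a)
  have hb : (1 : ℝ) ≤ (b : ℕ) := by exact_mod_cast one_le (a := b)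
  set x : ℝ := ((a : ℕ) : ℝ)
  set y : ℝ := ((b : ℕ) : ℝ)
  have hxy : 0 < x * y := by positivity
  have hn : 1 ≤ x * y * (x + y) := by
    have : 1 ≤ x * y := one_le_mul_of_one_le_of_one_le ha hb
    exact one_le_mul_of_one_le_of_one_le this (by linarith)
  have he : ((a : ℂ) * (b : ℂ) * ((a : ℂ) + (b : ℂ))) = ((x * y * (x + y) : ℝ) : ℂ) := by
    simp [x, y]
  -- Since xy ≤ (x + y)², the base dominates (xy)^(3/2). This separates the variables and produces
  -- the abscissa 2/3.
  have hpow : (x * y) ^ (3 / 2 : ℝ) ≤ x * y * (x + y) := by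
    refine le_of_sq_le_sq ?_ (by positivity)
    rw [← Real.rpow_natCast, ← Real.rpow_mul hxy.le]
    norm_num
    have : x * y ≤ (x + y) ^ 2 := by nlinarith
    calc (x * y) ^ 3 = (x * y) ^ 2 * (x * y) := by ring
      _ ≤ (x * y) ^ 2 * (x + y) ^ 2 := by gcongr
      _ = _ := by ring
  simp only [su3WittenTerm]
  rw [he, norm_div, norm_one, norm_cpow_eq_rpow_re_of_pos (by linarith), one_div,
    ← Real.rpow_neg (by linarith), ← Real.mul_rpow (by linarith) (by linarith)]
  calc (x * y * (x + y)) ^ (-s.re) ≤ (x * y * (x + y)) ^ (-σ) :=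
        Real.rpow_le_rpow_of_exponent_le hn (by linarith)
    _ ≤ ((x * y) ^ (3 / 2 : ℝ)) ^ (-σ) :=
        Real.rpow_le_rpow_of_nonpos (by positivity) hpow (by linarith)
    _ = (x * y) ^ (-(3 / 2 * σ)) := by
        rw [← Real.rpow_mul hxy.le]; ring_nf

theorem summable_su3WittenTerm_majorant {σ : ℝ} (hσ : 2 / 3 < σ) :
    Summable fun p : ℕ+ × ℕ+ =>
      ((p.1 : ℕ) : ℝ) ^ (-(3 / 2 * σ)) * ((p.2 : ℕ) : ℝ) ^ (-(3 / 2 * σ)) := by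
  have h : Summable fun a : ℕ+ => ((a : ℕ) : ℝ) ^ (-(3 / 2 * σ)) :=
    (Real.summable_nat_rpow.2 (by linarith)).comp_injective PNat.coe_injective
  exact h.mul_of_nonneg h (fun _ => by positivity) fun _ => by positivity

theorem summable_su3WittenTerm {s : ℂ} (hs : 2 / 3 < s.re) : Summable (su3WittenTerm s) :=
  Summable.of_norm_bounded (summable_su3WittenTerm_majorant hs)
    (norm_su3WittenTerm_le (by linarith) le_rfl)

theorem differentiable_su3WittenTerm (p : ℕ+ × ℕ+) :
    Differentiable ℂ fun s => su3WittenTerm s p := by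
  have h0 : ((p.1 : ℂ) * (p.2 : ℂ) * ((p.1 : ℂ) + (p.2 : ℂ))) ≠ 0 := by
    have : ((p.1 * p.2 * (p.1 + p.2) : ℕ+) : ℕ) ≠ 0 := PNat.ne_zero _
    have h : ((((p.1 * p.2 * (p.1 + p.2) : ℕ+) : ℕ)) : ℂ) ≠ 0 := by exact_mod_cast this
    simpa using h
  intro s
  exact (differentiableAt_const 1).div (differentiableAt_id.const_cpow (Or.inl h0))
    (by simp [cpow_eq_zero_iff, h0])

theorem differentiableOn_tsum_su3WittenTerm :
    DifferentiableOn ℂ (fun s => ∑' p, su3WittenTerm s p) {s | 2 / 3 < s.re} := by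
  intro s₀ hs₀
  obtain ⟨σ, h1, h2⟩ := exists_between (show 2 / 3 < s₀.re from hs₀)
  have hV : IsOpen {s : ℂ | σ < s.re} := isOpen_lt continuous_const continuous_re
  exact ((differentiableOn_tsum_of_summable_norm (summable_su3WittenTerm_majorant h1)
    (fun p => (differentiable_su3WittenTerm p).differentiableOn) hV
    fun p s hs => norm_su3WittenTerm_le (by linarith) (le_of_lt hs) p).differentiableAt
    (hV.mem_nhds h2)).differentiableWithinAt

/-! ### Values at 0 and at the negative even integers -/

theorem neg_two_mul_natCast_mem_leftRegion (m : ℕ) : (-(2 * m : ℕ) : ℂ) ∈ leftRegion := by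
  have h : ((-(2 * m : ℕ) : ℂ)).re = -(2 * m) := by simp
  have hm : (0 : ℝ) ≤ m := m.cast_nonneg
  exact ⟨by rw [h]; linarith, fun h1 => by rw [h1, one_re] at h; linarith⟩

theorem fourierFactor_neg_two_mul (m : ℕ) : fourierFactor (-(2 * m : ℕ)) = 0 := by
  have : cos (Real.pi * (1 - (-(2 * m : ℕ) : ℂ)) / 2) = 0 := by
    rw [Complex.cos_eq_zero_iff]
    exact ⟨m, by push_cast; ring⟩
  rw [fourierFactor, this, mul_zero]

/-- The cosine vanishes at 0 with derivative π/2, and the remaining factor equals 1/π there. -/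
theorem deriv_fourierFactor_zero : deriv fourierFactor 0 = 1 / 2 := by
  have hπ : (Real.pi : ℂ) ≠ 0 := by exact_mod_cast Real.pi_ne_zero
  have hu : DifferentiableAt ℂ
      (fun s : ℂ => 2 * (2 * Real.pi : ℂ) ^ (s - 1) * Gamma (1 - s)) 0 := by
    have hΓ : DifferentiableAt ℂ (fun s : ℂ => Gamma (1 - s)) 0 := by
      refine DifferentiableAt.comp (g := Gamma) 0 (differentiableAt_Gamma _ fun m h => ?_)
        (by fun_prop)
      have h' : ((m + 1 : ℕ) : ℂ) = 0 := by push_cast; linear_combination h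
      exact Nat.cast_ne_zero.2 m.succ_ne_zero h'
    exact ((DifferentiableAt.const_cpow (by fun_prop) (Or.inl (by simp [hπ]))).const_mul 2).mul hΓ
  have hv : HasDerivAt (fun s : ℂ => cos (Real.pi * (1 - s) / 2)) (Real.pi / 2) 0 := by
    have h1 : HasDerivAt (fun s : ℂ => Real.pi * (1 - s) / 2) (-(Real.pi / 2 : ℂ)) 0 := by
      have := (((hasDerivAt_id (0 : ℂ)).const_sub 1).const_mul (Real.pi : ℂ)).div_const 2
      exact this.congr_deriv (by ring)
    have h2 := h1.ccos
    convert h2 using 1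
    simp
  have h := (hu.hasDerivAt.mul hv).deriv
  have he : fourierFactor = (fun s : ℂ => 2 * (2 * Real.pi : ℂ) ^ (s - 1) * Gamma (1 - s)) *
      fun s : ℂ => cos (Real.pi * (1 - s) / 2) := rfl
  rw [he, h]
  simp only [zero_sub, sub_zero, mul_one, Complex.cos_pi_div_two, Complex.Gamma_one, cpow_neg_one]
  field_simp
  simp

theorem tendsto_cubeFinitePart_neg_even (m : ℕ) :
    Tendsto cubeFinitePart (𝓝[≠] (-(2 * m : ℕ) : ℂ))
      (𝓝 (3 * (deriv fourierFactor (-(2 * m : ℕ)) *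
          seqConv (cosCoeff · (-(2 * m : ℕ))) (cosCoeff · (-(2 * m : ℕ))) m) +
        finitePart (fun i => seqConv (cosCoeff · (-(2 * m : ℕ)))
          (seqConv (cosCoeff · (-(2 * m : ℕ))) (cosCoeff · (-(2 * m : ℕ)))) i) 1)) := by
  set s₀ : ℂ := (-(2 * m : ℕ) : ℂ) with hs₀
  have hs : s₀ ∈ leftRegion := neg_two_mul_natCast_mem_leftRegion m
  have hG0 : fourierFactor s₀ = 0 := fourierFactor_neg_two_mul m
  have hG := analyticAt_fourierFactor hs
  have n1 : 3 * s₀ - 2 ≠ 0 := fun h => by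
    have h' : ((3 * (2 * m) + 2 : ℕ) : ℂ) = 0 := by rw [hs₀] at h; push_cast at h ⊢; linear_combination -h
    exact Nat.cast_ne_zero.2 (Nat.succ_ne_zero _) h'
  -- At s₀ = -2m the number 2s₀ - 1 + 2i is an odd integer.
  have n2 : ∀ i : ℕ, 2 * s₀ - 1 + 2 * i ≠ 0 := fun i h => by
    have h' : ((2 * i : ℕ) : ℂ) = (2 * (2 * m) + 1 : ℕ) := by
      rw [hs₀] at h; push_cast at h ⊢; linear_combination h
    have : 2 * i = 2 * (2 * m) + 1 := by exact_mod_cast h'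
    omega
  have c1 := (analyticAt_half_cpow_div n1).continuousAt
  have c2 := (analyticAt_finitePart_cosCoeff hs n2).continuousAt
  have c4 := (analyticAt_finitePart_cosCoeff_cube hs).continuousAt
  obtain ⟨h, hh, he⟩ := finitePart_eq_singular_term_add (α := fun s => s) isOpen_leftRegion
    geomBounded_cosCoeff_sq (by fun_prop) hs (k := m) (by rw [hs₀]; push_cast; ring)
  have T1 : Tendsto (fun s => fourierFactor s ^ 3 *
      ((1 / 2 : ℂ) ^ (3 * s - 2) / (3 * s - 2))) (𝓝[≠] s₀) (𝓝 0) := by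
    have := (hG.continuousAt.tendsto.pow 3).mul c1.tendsto
    rw [hG0] at this
    simpa using this.mono_left nhdsWithin_le_nhds
  have T2 : Tendsto (fun s => 3 * (fourierFactor s ^ 2 *
      finitePart (cosCoeff · s) (2 * s - 1))) (𝓝[≠] s₀) (𝓝 0) := by
    have := ((hG.continuousAt.tendsto.pow 2).mul c2.tendsto).const_mul 3
    rw [hG0] at this
    simpa using this.mono_left nhdsWithin_le_nhds
  have hslope : Tendsto (fun s => fourierFactor s / (s + 2 * m)) (𝓝[≠] s₀)
      (𝓝 (deriv fourierFactor s₀)) := by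
    refine (hasDerivAt_iff_tendsto_slope.1 hG.differentiableAt.hasDerivAt).congr fun s => ?_
    rw [slope_def_field, hG0, hs₀]
    push_cast
    rw [sub_zero, sub_neg_eq_add]
  have T3 : Tendsto (fun s => fourierFactor s *
      finitePart (fun i => seqConv (cosCoeff · s) (cosCoeff · s) i) s) (𝓝[≠] s₀)
      (𝓝 (deriv fourierFactor s₀ * seqConv (cosCoeff · s₀) (cosCoeff · s₀) m)) := by
    have cb : ContinuousAt (fun s => seqConv (cosCoeff · s) (cosCoeff · s) m) s₀ :=
      ((geomBounded_cosCoeff_sq.differentiableOn m).continuousOn).continuousAt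
        (isOpen_leftRegion.mem_nhds hs)
    have cp : Tendsto (fun s : ℂ => (1 / 2 : ℂ) ^ (s + 2 * m)) (𝓝[≠] s₀) (𝓝 1) := by
      have : ContinuousAt (fun s : ℂ => (1 / 2 : ℂ) ^ (s + 2 * m)) s₀ :=
        ContinuousAt.const_cpow (by fun_prop) (Or.inl (by norm_num))
      have h0 : s₀ + 2 * m = 0 := by rw [hs₀]; push_cast; ring
      have := this.tendsto
      rw [h0, cpow_zero] at this
      exact this.mono_left nhdsWithin_le_nhds
    -- In the singular term the factor G(s)/(s + 2m) tends to G'(s₀). The regular remainder is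
    -- multiplied by G(s₀) = 0.
    have t1 := (hslope.mul (cb.tendsto.mono_left nhdsWithin_le_nhds)).mul cp
    have t2 := (hG.continuousAt.tendsto.mul hh.continuousAt.tendsto).mono_left
      (nhdsWithin_le_nhds (s := {s₀}ᶜ))
    have t := t1.add t2
    rw [hG0, zero_mul, add_zero, mul_one] at t
    refine t.congr' ?_
    filter_upwards [he.filter_mono nhdsWithin_le_nhds] with s hs'
    rw [hs']
    ring
  have := ((T1.add T2).add (T3.const_mul 3)).add
    (c4.tendsto.mono_left (nhdsWithin_le_nhds (s := {s₀}ᶜ)))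
  simp only [zero_add] at this
  exact this

theorem cosCoeff_succ_neg_even (m i : ℕ) : cosCoeff (i + 1) (-(2 * m : ℕ)) = 0 := by
  rw [cosCoeff, if_neg i.succ_ne_zero, fourierFactor_neg_two_mul, zero_mul]

theorem tendsto_cubeFinitePart_zero : Tendsto cubeFinitePart (𝓝[≠] 0) (𝓝 1) := by
  have h := tendsto_cubeFinitePart_neg_even 0
  have ha : (cosCoeff · (-(2 * 0 : ℕ) : ℂ)) = fun i => if i = 0 then (-1 : ℂ) else 0 := by
    ext i
    rcases i with _ | i
    · simp only [cosCoeff, if_true, mul_zero, Nat.cast_zero, neg_zero, riemannZeta_zero]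
      norm_num
    · rw [cosCoeff_succ_neg_even]; simp
  have hconv : ∀ u v : ℂ, seqConv (fun i => if i = 0 then u else 0)
      (fun i => if i = 0 then v else 0) = fun i => if i = 0 then u * v else 0 := by
    intro u v
    ext i
    rw [seqConv]
    rcases i with _ | i
    · simp
    · rw [if_neg i.succ_ne_zero]
      refine Finset.sum_eq_zero fun p hp => ?_
      have := Finset.HasAntidiagonal.mem_antidiagonal.1 hp
      split_ifs <;> first | omega | simp
  rw [ha, hconv, hconv] at h
  have hd : deriv fourierFactor (-(2 * 0 : ℕ) : ℂ) = 1 / 2 := by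
    simpa using deriv_fourierFactor_zero
  have hf : finitePart (fun i : ℕ => if i = 0 then (-1 : ℂ) * (-1 * -1) else 0) 1 = -(1 / 2) := by
    rw [finitePart, tsum_eq_single 0 (fun i hi => by simp [hi])]
    simp
  rw [hd, hf] at h
  have hv : 3 * (1 / 2 * (fun i : ℕ => if i = 0 then (-1 : ℂ) * -1 else 0) 0) + -(1 / 2) = 1 := by
    norm_num
  rw [hv] at h
  simpa using h

theorem tendsto_cubeFinitePart_neg_even_pos {m : ℕ} (hm : m ≠ 0) :
    Tendsto cubeFinitePart (𝓝[≠] (-(2 * m : ℕ) : ℂ)) (𝓝 0) := by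
  have h := tendsto_cubeFinitePart_neg_even m
  have ha : (cosCoeff · (-(2 * m : ℕ) : ℂ)) = fun _ => 0 := by
    ext i
    rcases i with _ | i
    · obtain ⟨k, rfl⟩ := Nat.exists_eq_succ_of_ne_zero hm
      have := riemannZeta_neg_two_mul_nat_add_one k
      simp only [cosCoeff, if_true]
      rw [show (-(2 * (k.succ) : ℕ) : ℂ) = -2 * (k + 1) by push_cast; ring, this, mul_zero]
    · exact cosCoeff_succ_neg_even m i
  rw [ha] at h
  simpa [seqConv, finitePart] using h

/-! ### Values at the negative odd integers: a primitive of the cubed Eisenstein series -/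

/-- The primitive of the Laurent series `z ^ (k - 1) * ∑ b i * z ^ (2 * i)`, for odd `k`. -/
noncomputable def laurentPrimitive (b : ℕ → ℂ) (k : ℤ) (z : ℂ) : ℂ :=
  ∑' i : ℕ, b i * (z ^ (k + 2 * i) / ((k + 2 * i : ℤ) : ℂ))

theorem laurentPrimitive_neg (b : ℕ → ℂ) {k : ℤ} (hk : Odd k) (z : ℂ) :
    laurentPrimitive b k (-z) = -laurentPrimitive b k z := by
  rw [laurentPrimitive, laurentPrimitive, ← tsum_neg]
  refine tsum_congr fun i => ?_
  have : Odd (k + 2 * i) := hk.add_even (even_two_mul _)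
  rw [this.neg_zpow]
  ring

theorem laurentPrimitive_half (b : ℕ → ℂ) (k : ℤ) :
    laurentPrimitive b k (1 / 2) = finitePart b k := by
  rw [laurentPrimitive, finitePart]
  refine tsum_congr fun i => ?_
  rw [← cpow_intCast]
  push_cast
  rfl

theorem hasDerivAt_zpow_div {k : ℤ} (hk : k ≠ 0) {z : ℂ} (hz : z ≠ 0) :
    HasDerivAt (fun z : ℂ => z ^ k / (k : ℂ)) (z ^ (k - 1)) z := by
  have hk' : (k : ℂ) ≠ 0 := by exact_mod_cast hk
  have := (hasDerivAt_zpow k z (Or.inl hz)).div_const (k : ℂ)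
  rwa [mul_div_cancel_left₀ _ hk'] at this

theorem norm_zpow_le {δ r : ℝ} (hδ : 0 < δ) {z : ℂ} (h1 : δ ≤ ‖z‖) (h2 : ‖z‖ ≤ r) (k : ℤ) :
    ‖z ^ k‖ ≤ δ ^ k + r ^ k := by
  rw [norm_zpow]
  have hr : 0 < r := hδ.trans_le (h1.trans h2)
  rcases le_total 0 k with hk | hk
  · exact (zpow_le_zpow_left₀ hk (norm_nonneg z) h2).trans (le_add_of_nonneg_left (by positivity))
  · refine le_trans ?_ (le_add_of_nonneg_right (by positivity))
    obtain ⟨n, rfl⟩ := Int.exists_eq_neg_ofNat hk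
    rw [zpow_neg, zpow_neg, zpow_natCast, zpow_natCast]
    gcongr

/-- Since k is odd, no exponent k + 2i is 0, so no logarithm occurs. Termwise differentiation is
justified on an annulus around z that avoids 0, where the negative powers are bounded. -/
theorem hasDerivAt_laurentPrimitive {b : ℕ → ℂ} {C : ℝ} (hb : ∀ i, ‖b i‖ ≤ C * 3 ^ i) {k : ℤ}
    (hk : Odd k) {z : ℂ} (hz0 : z ≠ 0) (hz : 3 * ‖z‖ ^ 2 < 1) :
    HasDerivAt (laurentPrimitive b k) (z ^ (k - 1) * ∑' i : ℕ, b i * z ^ (2 * i)) z := by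
  have hC : 0 ≤ C := by simpa using (norm_nonneg _).trans (hb 0)
  have hpos : 0 < ‖z‖ := norm_pos_iff.2 hz0
  obtain ⟨r, hr1, hr2⟩ : ∃ r, ‖z‖ < r ∧ 3 * r ^ 2 < 1 := by
    have hc : ContinuousAt (fun r : ℝ => 3 * r ^ 2) ‖z‖ := by fun_prop
    have h1 : ∀ᶠ r in 𝓝[>] ‖z‖, 3 * r ^ 2 < 1 :=
      (hc.eventually (gt_mem_nhds hz)).filter_mono nhdsWithin_le_nhds
    exact ((eventually_mem_nhdsWithin.and h1).exists)
  set δ := ‖z‖ / 2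
  have hδ : 0 < δ := by positivity
  set U : Set ℂ := {w | δ < ‖w‖ ∧ ‖w‖ < r} with hU
  have hUo : IsOpen U := (isOpen_lt continuous_const continuous_norm).inter
    (isOpen_lt continuous_norm continuous_const)
  have hzU : z ∈ U := ⟨half_lt_self hpos, hr1⟩
  have hne : ∀ w ∈ U, w ≠ 0 := fun w hw => norm_pos_iff.1 (hδ.trans hw.1)
  have hodd : ∀ i : ℕ, Odd (k + 2 * i) := fun i => hk.add_even (even_two_mul _)
  have hki : ∀ i : ℕ, k + 2 * i ≠ 0 := fun i h => by
    have := hodd i; rw [h] at this; exact absurd this (by decide)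
  have hd : ∀ i : ℕ, ∀ w ∈ U, HasDerivAt
      (fun z : ℂ => b i * (z ^ (k + 2 * i) / ((k + 2 * i : ℤ) : ℂ)))
      (b i * w ^ (k + 2 * i - 1)) w := fun i w hw =>
    (hasDerivAt_zpow_div (hki i) (hne w hw)).const_mul _
  have hsum : Summable fun i : ℕ => (δ ^ k + r ^ k) * C * (3 * r ^ 2) ^ i :=
    (summable_geometric_of_lt_one (by positivity) hr2).mul_left _
  have hdiff : ∀ i : ℕ, DifferentiableOn ℂ
      (fun z : ℂ => b i * (z ^ (k + 2 * i) / ((k + 2 * i : ℤ) : ℂ))) U := fun i w hw =>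
    (hd i w hw).differentiableAt.differentiableWithinAt
  have hbd : ∀ (i : ℕ), ∀ w ∈ U, ‖b i * (w ^ (k + 2 * i) / ((k + 2 * i : ℤ) : ℂ))‖ ≤
      (δ ^ k + r ^ k) * C * (3 * r ^ 2) ^ i := by
    intro i w hw
    have h1 : (1 : ℝ) ≤ ‖((k + 2 * i : ℤ) : ℂ)‖ := by
      rw [norm_intCast]
      exact_mod_cast Int.one_le_abs (hki i)
    have h2 : ‖w ^ (2 * (i : ℤ))‖ ≤ (r ^ 2) ^ i := by
      rw [show (2 * (i : ℤ)) = ((2 * i : ℕ) : ℤ) by push_cast; ring, zpow_natCast, norm_pow,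
        ← pow_mul]
      exact pow_le_pow_left₀ (norm_nonneg w) hw.2.le _
    have h3 := norm_zpow_le hδ hw.1.le hw.2.le k
    have h4 : 0 ≤ δ ^ k + r ^ k := (norm_nonneg _).trans h3
    rw [norm_mul, norm_div, zpow_add₀ (hne w hw), norm_mul]
    calc ‖b i‖ * (‖w ^ k‖ * ‖w ^ (2 * (i : ℤ))‖ / ‖((k + 2 * i : ℤ) : ℂ)‖)
        ≤ (C * 3 ^ i) * ((δ ^ k + r ^ k) * (r ^ 2) ^ i / 1) := by
          gcongr
          exact hb i
      _ = _ := by rw [mul_pow]; ring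
  have hderiv := hasSum_deriv_of_summable_norm hsum hdiff hUo hbd hzU
  have hD := (differentiableOn_tsum_of_summable_norm hsum hdiff hUo hbd).differentiableAt
    (hUo.mem_nhds hzU)
  have he : deriv (fun w : ℂ => ∑' i : ℕ, b i * (w ^ (k + 2 * i) / ((k + 2 * i : ℤ) : ℂ))) z =
      z ^ (k - 1) * ∑' i : ℕ, b i * z ^ (2 * i) := by
    rw [← hderiv.tsum_eq, ← tsum_mul_left]
    refine tsum_congr fun i => ?_
    rw [(hd i z hzU).deriv, show k + 2 * (i : ℤ) - 1 = (k - 1) + ((2 * i : ℕ) : ℤ) by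
      push_cast; ring, zpow_add₀ hz0, zpow_natCast]
    ring
  rw [← he]
  exact hD.hasDerivAt

/-- A primitive of `(z ^ (-(n + 1)) + ∑ e i * z ^ (2 * i)) ^ 3`, for odd `n`. -/
noncomputable def cubePrimitive (e : ℕ → ℂ) (n : ℕ) (z : ℂ) : ℂ :=
  z ^ (-(3 * n + 2) : ℤ) / ((-(3 * n + 2) : ℤ) : ℂ) +
    3 * laurentPrimitive e (-(2 * n + 1)) z +
    3 * laurentPrimitive (seqConv e e) (-n) z +
    laurentPrimitive (seqConv e (seqConv e e)) 1 z

theorem cubePrimitive_neg (e : ℕ → ℂ) {n : ℕ} (hn : Odd n) (z : ℂ) :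
    cubePrimitive e n (-z) = -cubePrimitive e n z := by
  have hn' : Odd (n : ℤ) := by exact_mod_cast hn
  have h1 : Odd (-(3 * n + 2) : ℤ) := by
    rw [odd_neg]; exact (Odd.mul (by decide) hn').add_even (by decide)
  have h2 : Odd (-(2 * n + 1) : ℤ) := by rw [odd_neg]; exact odd_two_mul_add_one _
  rw [cubePrimitive, cubePrimitive, h1.neg_zpow, laurentPrimitive_neg _ h2,
    laurentPrimitive_neg _ hn'.neg, laurentPrimitive_neg _ odd_one]
  ring

theorem hasDerivAt_cubePrimitive {e : ℕ → ℂ} {C : ℝ} (hC : 0 ≤ C) (he : ∀ i, ‖e i‖ ≤ C * 2 ^ i)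
    {n : ℕ} (hn : Odd n) {z : ℂ} (hz0 : z ≠ 0) (hz : 3 * ‖z‖ ^ 2 < 1) :
    HasDerivAt (cubePrimitive e n)
      (((z ^ (n + 1))⁻¹ + ∑' i : ℕ, e i * z ^ (2 * i)) ^ 3) z := by
  have hn' : Odd (n : ℤ) := by exact_mod_cast hn
  have h2 : Odd (-(2 * n + 1) : ℤ) := by rw [odd_neg]; exact odd_two_mul_add_one _
  have h1 : (-(3 * n + 2) : ℤ) ≠ 0 := by omega
  have he3 := norm_le_mul_three_pow he
  have hee := norm_seqConv_le hC he he3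
  have heee := norm_seqConv_le hC he hee
  have d := (((hasDerivAt_zpow_div h1 hz0).add
    ((hasDerivAt_laurentPrimitive he3 h2 hz0 hz).const_mul 3)).add
    ((hasDerivAt_laurentPrimitive hee hn'.neg hz0 hz).const_mul 3)).add
    (hasDerivAt_laurentPrimitive heee odd_one hz0 hz)
  refine HasDerivAt.congr_deriv d ?_
  rw [← tsum_mul_tsum_eq_tsum_seqConv he3 hee hz, ← tsum_mul_tsum_eq_tsum_seqConv he3 he3 hz,
    show (-(3 * n + 2) : ℤ) - 1 = -((((n + 1) * 3 : ℕ)) : ℤ) by push_cast; ring,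
    show (-(2 * n + 1) : ℤ) - 1 = -((((n + 1) * 2 : ℕ)) : ℤ) by push_cast; ring,
    show (-n : ℤ) - 1 = -(((n + 1 : ℕ)) : ℤ) by push_cast; ring,
    sub_self, zpow_zero, zpow_neg, zpow_neg, zpow_neg, zpow_natCast, zpow_natCast, zpow_natCast,
    pow_mul, pow_mul]
  ring

/-- The Laurent expansion of the Eisenstein series `∑ 1 / (z + m) ^ (n + 1)` at `z = 0`. -/
theorem tsum_int_eq_laurent {n : ℕ} (hn : Odd n) {z : ℂ} (hz : 3 * ‖z‖ ^ 2 < 1) :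
    ∑' m : ℤ, 1 / (z + m) ^ (n + 1) =
      (z ^ (n + 1))⁻¹ + ∑' i : ℕ, latticeCoeff i (-n) * z ^ (2 * i) := by
  have hn1 : 1 ≤ n := hn.pos
  have hev : Even (n + 1) := hn.add_one
  have hsum : Summable fun m : ℤ => 1 / (z + m) ^ (n + 1) := by
    have := EisensteinSeries.linear_right_summable z 1 (k := (n + 1 : ℕ)) (by omega)
    refine this.congr fun m => ?_
    rw [zpow_natCast]
    simp
  -- Pairing m with -m counts m = 0 twice. Removing the pair of index 0 leaves the full sum minus
  -- one copy of 1/z^(n+1).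
  have h := hsum.hasSum.nat_add_neg
  rw [← hasSum_nat_add_iff' 1] at h
  have hre : ((-n : ℂ) - 1).re < -1 := by
    have : (0 : ℝ) < n := by exact_mod_cast hn1
    simp only [sub_re, neg_re, natCast_re, one_re]
    linarith
  have hT := (hasSum_shifted_cpow hre (z := z) (by linarith)).1
  have hcongr : ∀ m : ℕ, ((m : ℂ) + 1 + z) ^ ((-n : ℂ) - 1) + ((m : ℂ) + 1 - z) ^ ((-n : ℂ) - 1) =
      1 / (z + ((m + 1 : ℕ) : ℤ)) ^ (n + 1) + 1 / (z + ((-((m + 1 : ℕ) : ℤ) : ℤ) : ℂ)) ^ (n + 1) := by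
    intro m
    rw [show ((-n : ℂ) - 1) = -((n + 1 : ℕ) : ℂ) by push_cast; ring, cpow_neg, cpow_neg,
      cpow_natCast, cpow_natCast, ← hev.neg_pow ((m : ℂ) + 1 - z)]
    push_cast
    rw [one_div, one_div]
    congr 3 <;> ring
  have hu := h.unique (hT.congr_fun fun m => (hcongr m).symm)
  have hu' : ∑' i : ℕ, latticeCoeff i (-n) * z ^ (2 * i) =
      ∑' i : ℕ, 2 * Ring.choose ((-n : ℂ) - 1) (2 * i) * riemannZeta (2 * i - ((-n : ℂ) - 1)) *
        z ^ (2 * i) := rfl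
  rw [hu', ← hu]
  simp

theorem summable_norm_pow_mul_exp (n : ℕ) {ε : ℝ} (hε : 0 < ε) (K : ℂ) :
    Summable fun a : ℕ+ => ‖K * ((a : ℂ) ^ n * cexp (-(2 * Real.pi * a * ε : ℝ)))‖ := by
  have h := (Real.summable_pow_mul_exp_neg_nat_mul n (r := 2 * Real.pi * ε) (by positivity)).comp_injective
    PNat.coe_injective
  refine (h.mul_left ‖K‖).congr fun a => ?_
  rw [norm_mul, norm_mul, norm_pow, Complex.norm_natCast, ← ofReal_neg, Complex.norm_exp_ofReal]
  simp only [Function.comp]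
  congr 3
  ring

/-- This is Lipschitz's formula on the line of height ε. Positive height damps the coefficients
exponentially and makes them summable. -/
theorem exists_tsum_int_eq_halfFourierSeries {n : ℕ} (hn : 1 ≤ n) {ε : ℝ} (hε : 0 < ε) :
    ∃ c : ℕ+ → ℂ, (Summable fun a => ‖c a‖) ∧ ∀ x : ℝ,
      ∑' m : ℤ, 1 / ((x : ℂ) + ε * I + m) ^ (n + 1) = halfFourierSeries c 1 x := by
  refine ⟨fun a => (-2 * Real.pi * I) ^ (n + 1) / n.factorial *
    ((a : ℂ) ^ n * cexp (-(2 * Real.pi * a * ε : ℝ))), summable_norm_pow_mul_exp n hε _,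
    fun x => ?_⟩
  have h : ∑' m : ℤ, 1 / ((x : ℂ) + ε * I + m) ^ (n + 1) =
      (-2 * Real.pi * I) ^ (n + 1) / n.factorial *
        ∑' a : ℕ+, (a : ℂ) ^ n * cexp (2 * Real.pi * I * ((x : ℂ) + ε * I)) ^ (a : ℕ) :=
    EisensteinSeries.qExpansion_identity_pnat hn ⟨(x : ℂ) + ε * I, by simpa using hε⟩
  rw [h, halfFourierSeries, ← tsum_mul_left]
  refine tsum_congr fun a => ?_
  have e : cexp (2 * Real.pi * I * ((x : ℂ) + ε * I)) ^ (a : ℕ) =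
      cexp (-(2 * Real.pi * a * ε : ℝ)) * cexp (2 * Real.pi * I * ((1 * a : ℤ) : ℂ) * x) := by
    rw [← Complex.exp_nat_mul, ← Complex.exp_add]
    congr 1
    push_cast
    linear_combination (2 * Real.pi * a * ε : ℂ) * I_sq
  rw [e]
  ring

theorem intervalIntegral_halfFourierSeries_cube {c : ℕ+ → ℂ} (hc : Summable fun a => ‖c a‖) :
    ∫ x in (-(1 / 2) : ℝ)..(1 / 2), halfFourierSeries c 1 x ^ 3 = 0 := by
  have hper : Function.Periodic (fun x : ℝ => halfFourierSeries c 1 x ^ 3) 1 := by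
    intro x
    simp only [halfFourierSeries]
    congr 1
    refine tsum_congr fun a => ?_
    rw [show (2 * Real.pi * I * ((1 * a : ℤ) : ℂ) * ((x + 1 : ℝ) : ℂ)) =
      2 * Real.pi * I * ((1 * a : ℤ) : ℂ) * x + (a : ℕ) * (2 * Real.pi * I) by push_cast; ring,
      Complex.exp_add, exp_nat_mul_two_pi_mul_I, mul_one]
  have h := hper.intervalIntegral_add_eq (-(1 / 2)) 0
  rw [show (-(1 / 2) : ℝ) + 1 = 1 / 2 by norm_num, zero_add] at h
  rw [h, intervalIntegral.integral_of_le zero_le_one,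
    ← integral_halfFourierSeries_same hc one_ne_zero]
  exact integral_congr_ae (Eventually.of_forall fun x => by ring)

theorem cubePrimitive_latticeCoeff_half {n : ℕ} (hn : Odd n) :
    cubePrimitive (latticeCoeff · (-n)) n (1 / 2) = 0 := by
  obtain ⟨C, hC, he⟩ := exists_norm_latticeCoeff_le (s := -n) (by
    have : (0 : ℝ) ≤ n := n.cast_nonneg
    simp; linarith)
  set L := cubePrimitive (latticeCoeff · (-n)) n
  have hL : ∀ z : ℂ, z ≠ 0 → 3 * ‖z‖ ^ 2 < 1 →
      HasDerivAt L ((∑' m : ℤ, 1 / (z + m) ^ (n + 1)) ^ 3) z := fun z h0 hz => by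
    rw [tsum_int_eq_laurent hn hz]
    exact hasDerivAt_cubePrimitive hC he hn h0 hz
  -- For |x| ≤ 1/2 and ε < 1/4, 3|x + iε|² < 15/16, so the segment lies where the Laurent expansion
  -- is valid; ε > 0 keeps it away from the pole at 0.
  have key : ∀ ε : ℝ, 0 < ε → ε < 1 / 4 → L ((1 / 2 : ℝ) + ε * I) = L ((-(1 / 2) : ℝ) + ε * I) := by
    intro ε h0 h1
    obtain ⟨c, hc, hcx⟩ := exists_tsum_int_eq_halfFourierSeries hn.pos h0
    have hd : ∀ x ∈ uIcc (-(1 / 2) : ℝ) (1 / 2),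
        HasDerivAt (fun x : ℝ => L (x + ε * I)) (halfFourierSeries c 1 x ^ 3) x := by
      intro x hx
      rw [uIcc_of_le (by norm_num)] at hx
      rw [← hcx]
      have hz0 : (x : ℂ) + ε * I ≠ 0 := fun h => by
        have := congrArg im h
        simp at this; linarith
      have hz : 3 * ‖(x : ℂ) + ε * I‖ ^ 2 < 1 := by
        rw [← normSq_eq_norm_sq, normSq_add_mul_I]
        nlinarith [hx.1, hx.2]
      have h2 : HasDerivAt (fun x : ℂ => x + ε * I) 1 (x : ℂ) := (hasDerivAt_id _).add_const _
      have h3 := HasDerivAt.comp (x : ℂ) (hL _ hz0 hz) h2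
      rw [mul_one] at h3
      exact h3.comp_ofReal
    have hcont := continuous_halfFourierSeries hc 1
    have := intervalIntegral.integral_eq_sub_of_hasDerivAt hd
      ((hcont.pow 3).intervalIntegrable _ _)
    rw [intervalIntegral_halfFourierSeries_cube hc] at this
    exact (sub_eq_zero.1 this.symm)
  have hlim : ∀ z : ℂ, z ≠ 0 → 3 * ‖z‖ ^ 2 < 1 →
      Tendsto (fun ε : ℝ => L (z + ε * I)) (𝓝[>] 0) (𝓝 (L z)) := by
    intro z h0 hz
    have h1 : Tendsto (fun ε : ℝ => z + ε * I) (𝓝[>] 0) (𝓝 z) := by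
      have : Continuous fun ε : ℝ => z + ε * I := by fun_prop
      have := this.tendsto 0
      simp only [ofReal_zero, zero_mul, add_zero] at this
      exact this.mono_left nhdsWithin_le_nhds
    exact (hL z h0 hz).continuousAt.tendsto.comp h1
  have l1 := hlim ((1 / 2 : ℝ)) (by norm_num) (by norm_num)
  have l2 := hlim ((-(1 / 2) : ℝ)) (by norm_num) (by norm_num)
  have heq : L ((1 / 2 : ℝ)) = L ((-(1 / 2) : ℝ)) := by
    refine tendsto_nhds_unique (l1.congr' ?_) l2
    filter_upwards [Ioo_mem_nhdsGT (show (0 : ℝ) < 1 / 4 by norm_num)] with ε hε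
    exact key ε hε.1 hε.2
  have hodd : L ((-(1 / 2) : ℝ)) = -L ((1 / 2 : ℝ)) := by
    rw [ofReal_neg]; exact cubePrimitive_neg _ hn _
  have : L ((1 / 2 : ℝ)) = 0 := by
    rw [hodd] at heq
    exact self_eq_neg.1 heq
  simpa using this

theorem seqConv_const_mul (u v : ℂ) (a b : ℕ → ℂ) :
    seqConv (fun i => u * a i) (fun i => v * b i) = fun i => u * v * seqConv a b i := by
  ext i
  rw [seqConv, seqConv, Finset.mul_sum]
  exact Finset.sum_congr rfl fun p _ => by ring

theorem finitePart_const_mul (u : ℂ) (b : ℕ → ℂ) (α : ℂ) :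
    finitePart (fun i => u * b i) α = u * finitePart b α := by
  rw [finitePart, finitePart, ← tsum_mul_left]
  exact tsum_congr fun i => by ring

/-- At s = -n every `cosCoeff` is G times `latticeCoeff`, so G³ factors out and the remaining sum is
the primitive at 1/2. -/
theorem cubeFinitePart_neg_odd {n : ℕ} (hn : Odd n) : cubeFinitePart (-n) = 0 := by
  have hne : ∀ k : ℕ, (-n : ℂ) ≠ k + 1 := fun k h => by
    have h' : ((n + (k + 1) : ℕ) : ℂ) = 0 := by push_cast; linear_combination -h
    exact Nat.cast_ne_zero.2 (by omega) h'
  have hn0 : (-n : ℂ) ≠ 0 := by simpa using hn.pos.ne'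
  have hL := cubePrimitive_latticeCoeff_half hn
  set e : ℕ → ℂ := (latticeCoeff · (-n))
  have ha : (cosCoeff · (-n : ℂ)) = fun i => fourierFactor (-n) * e i :=
    funext fun i => cosCoeff_eq hne hn0 i
  rw [cubePrimitive, laurentPrimitive_half, laurentPrimitive_half, laurentPrimitive_half] at hL
  have h1 : (1 / 2 : ℂ) ^ (-(3 * n + 2) : ℤ) = (1 / 2 : ℂ) ^ (3 * (-n : ℂ) - 2) := by
    rw [← cpow_intCast]; congr 1; push_cast; ring
  rw [h1] at hL
  rw [cubeFinitePart, ha, seqConv_const_mul, seqConv_const_mul, finitePart_const_mul,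
    finitePart_const_mul, finitePart_const_mul]
  push_cast at hL
  rw [show (3 * (-n : ℂ) - 2) = -(3 * n + 2) by ring,
    show (2 * (-n : ℂ) - 1) = -(2 * n + 1) by ring]
  rw [show (3 * (-n : ℂ) - 2) = -(3 * n + 2) by ring] at hL
  linear_combination fourierFactor (-n) ^ 3 * hL

theorem tendsto_cubeFinitePart_neg_odd {n : ℕ} (hn : Odd n) :
    Tendsto cubeFinitePart (𝓝[≠] (-n : ℂ)) (𝓝 0) := by
  have hs : (-n : ℂ) ∈ leftRegion := by
    have h : ((-n : ℂ)).re = -n := by simp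
    have hm : (0 : ℝ) ≤ n := n.cast_nonneg
    exact ⟨by rw [h]; linarith, fun h1 => by rw [h1, one_re] at h; linarith⟩
  have h := (analyticAt_cubeFinitePart hs ?_ ?_ ?_).continuousAt.tendsto
  · rw [cubeFinitePart_neg_odd hn] at h
    exact h.mono_left nhdsWithin_le_nhds
  · intro h
    have h' : ((3 * n + 2 : ℕ) : ℂ) = 0 := by push_cast; linear_combination -h
    exact Nat.cast_ne_zero.2 (by omega) h'
  · intro i h
    have h' : ((2 * i : ℕ) : ℂ) = (2 * n + 1 : ℕ) := by push_cast; linear_combination h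
    have : 2 * i = 2 * n + 1 := by exact_mod_cast h'
    omega
  · intro i h
    have h' : ((2 * i : ℕ) : ℂ) = n := by push_cast; linear_combination h
    have : 2 * i = n := by exact_mod_cast h'
    obtain ⟨k, hk⟩ := hn
    omega

/-! ### Gluing, uniqueness and conclusion -/

theorem isPreconnected_strip_diff_one :
    IsPreconnected {s : ℂ | 2 / 3 < s.re ∧ s.re < 2 ∧ s ≠ 1} := by
  have c1 : IsPreconnected {s : ℂ | 1 < s.re ∧ s.re < 2} :=
    ((convex_halfSpace_re_gt 1).inter (convex_halfSpace_re_lt 2)).isPreconnected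
  have c2 : IsPreconnected {s : ℂ | 2 / 3 < s.re ∧ s.re < 1} :=
    ((convex_halfSpace_re_gt (2 / 3)).inter (convex_halfSpace_re_lt 1)).isPreconnected
  have c3 : IsPreconnected {s : ℂ | (2 / 3 < s.re ∧ s.re < 2) ∧ 0 < s.im} :=
    (((convex_halfSpace_re_gt (2 / 3)).inter (convex_halfSpace_re_lt 2)).inter
      (convex_halfSpace_im_gt 0)).isPreconnected
  have c4 : IsPreconnected {s : ℂ | (2 / 3 < s.re ∧ s.re < 2) ∧ s.im < 0} :=
    (((convex_halfSpace_re_gt (2 / 3)).inter (convex_halfSpace_re_lt 2)).inter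
      (convex_halfSpace_im_lt 0)).isPreconnected
  -- The punctured strip is covered by four convex pieces, chained through the common points 3/2 +
  -- i, 3/4 + i and 3/2 - i.
  have h := ((c1.union (⟨3 / 2, 1⟩ : ℂ) (by norm_num) (by norm_num) c3).union (⟨3 / 4, 1⟩ : ℂ)
    (Or.inr (by norm_num)) (by norm_num) c2).union (⟨3 / 2, -1⟩ : ℂ)
    (Or.inl (Or.inl (by norm_num))) (by norm_num) c4
  convert h using 1
  ext s
  simp only [mem_ofPred_eq, mem_union]
  constructor
  · rintro ⟨h1, h2, h3⟩
    rcases lt_trichotomy s.im 0 with h4 | h4 | h4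
    · exact Or.inr ⟨⟨h1, h2⟩, h4⟩
    · rcases lt_trichotomy s.re 1 with h5 | h5 | h5
      · exact Or.inl (Or.inr ⟨h1, h5⟩)
      · exact absurd (Complex.ext h5 h4) h3
      · exact Or.inl (Or.inl (Or.inl ⟨h5, h2⟩))
    · exact Or.inl (Or.inl (Or.inr ⟨⟨h1, h2⟩, h4⟩))
  · rintro (((⟨h1, h2⟩ | ⟨⟨h1, h2⟩, h3⟩) | ⟨h1, h2⟩) | ⟨⟨h1, h2⟩, h3⟩) <;>
      refine ⟨by linarith, by linarith, ?_⟩ <;> rintro rfl <;> simp at *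

theorem tsum_su3WittenTerm_eq_cubeFinitePart {s : ℂ} (h1 : 2 / 3 < s.re) (h2 : s.re < 2)
    (h3 : s ≠ 1) : ∑' p, su3WittenTerm s p = cubeFinitePart s / 3 := by
  have hA : AnalyticOnNhd ℂ (fun s => ∑' p, su3WittenTerm s p)
      {s : ℂ | 2 / 3 < s.re ∧ s.re < 2 ∧ s ≠ 1} := fun z hz =>
    differentiableOn_tsum_su3WittenTerm.analyticAt
      ((isOpen_lt continuous_const continuous_re).mem_nhds hz.1)
  have hB : AnalyticOnNhd ℂ (fun s => cubeFinitePart s / 3)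
      {s : ℂ | 2 / 3 < s.re ∧ s.re < 2 ∧ s ≠ 1} := by
    rintro z ⟨k1, k2, k3⟩
    have hi : ∀ i : ℕ, (0 : ℝ) ≤ i := fun i => i.cast_nonneg
    refine (analyticAt_cubeFinitePart ⟨k2, k3⟩ (fun h => ?_) (fun i h => ?_)
      (fun i h => ?_)).div analyticAt_const (by norm_num)
    all_goals
      have := congrArg re h
      simp at this
    · linarith
    · linarith [hi i]
    · linarith [hi i]
  refine hA.eqOn_of_preconnected_of_eventuallyEq hB isPreconnected_strip_diff_one
    (z₀ := (⟨3 / 2, 0⟩ : ℂ)) ⟨by norm_num, by norm_num, fun h => ?_⟩ ?_ ⟨h1, h2, h3⟩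
  · have := congrArg re h
    norm_num at this
  · have e : ∀ᶠ s : ℂ in 𝓝 (⟨3 / 2, 0⟩ : ℂ), 1 < s.re ∧ s.re < 2 :=
      (continuous_re.continuousAt.eventually (lt_mem_nhds (by norm_num))).and
        (continuous_re.continuousAt.eventually (gt_mem_nhds (by norm_num)))
    filter_upwards [e] with s hs
    rw [← three_mul_tsum_su3WittenTerm hs.1 hs.2]
    ring

open Classical in
/-- The series on `Re s > 2 / 3`, extended by `cubeFinitePart s / 3`. -/
noncomputable def gluedWittenZeta (s : ℂ) : ℂ :=
  if 2 / 3 < s.re then ∑' p, su3WittenTerm s p else cubeFinitePart s / 3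

theorem analyticAt_gluedWittenZeta {s : ℂ} (hs : 2 / 3 < s.re) :
    AnalyticAt ℂ gluedWittenZeta s := by
  have hU := (isOpen_lt (continuous_const (y := (2 / 3 : ℝ))) continuous_re).mem_nhds hs
  refine (differentiableOn_tsum_su3WittenTerm.analyticAt hU).congr ?_
  filter_upwards [hU] with z hz
  exact (if_pos hz).symm

/-- On the overlap 2/3 < `Re s` < 1 the two branches agree, so the definition by cases leaves no
seam along `Re s` = 2/3. -/
theorem gluedWittenZeta_eventuallyEq {s : ℂ} (hs : s.re < 1) :
    gluedWittenZeta =ᶠ[𝓝 s] fun s => cubeFinitePart s / 3 := by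
  filter_upwards [(isOpen_lt continuous_re continuous_const).mem_nhds hs] with z hz
  have hz' : z.re < 1 := hz
  rw [gluedWittenZeta]
  split_ifs with h
  · refine tsum_su3WittenTerm_eq_cubeFinitePart h (by linarith) ?_
    rintro rfl
    simp at hz'
  · rfl

theorem meromorphicOn_gluedWittenZeta : MeromorphicOn gluedWittenZeta univ := by
  intro s _
  rcases lt_or_ge (2 / 3) s.re with hs | hs
  · exact (analyticAt_gluedWittenZeta hs).meromorphicAt
  · have h1 : s.re < 1 := by linarith
    have hm : MeromorphicAt (fun s => cubeFinitePart s / 3) s := by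
      refine (meromorphicAt_cubeFinitePart ⟨by linarith, ?_⟩).div
        analyticAt_const.meromorphicAt
      rintro rfl
      simp at h1
    exact hm.congr ((gluedWittenZeta_eventuallyEq h1).symm.filter_mono nhdsWithin_le_nhds)

theorem isSU3WittenZeta_toMeromorphicNFOn :
    IsSU3WittenZeta (toMeromorphicNFOn gluedWittenZeta univ) := by
  refine ⟨meromorphicNFOn_toMeromorphicNFOn _ _, fun s hs => ?_⟩
  rw [toMeromorphicNFOn_eq_toMeromorphicNFAt meromorphicOn_gluedWittenZeta (mem_univ s),
    toMeromorphicNFAt_eq_self.2 (analyticAt_gluedWittenZeta hs).meromorphicNFAt, gluedWittenZeta,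
    if_pos hs]
  exact (summable_su3WittenTerm hs).hasSum

/-- The difference has infinite order at z₀, hence everywhere because the plane is connected. Normal
form upgrades agreement on punctured neighbourhoods to agreement at each point, poles included. -/
theorem MeromorphicNFOn.eq_of_eventuallyEq {f g : ℂ → ℂ} (hf : MeromorphicNFOn f univ)
    (hg : MeromorphicNFOn g univ) {z₀ : ℂ} (h : f =ᶠ[𝓝 z₀] g) : f = g := by
  have hm : Meromorphic (f - g) := fun z =>
    (hf (mem_univ z)).meromorphicAt.sub (hg (mem_univ z)).meromorphicAt
  have htop : ∀ z, meromorphicOrderAt (f - g) z = ⊤ := by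
    by_contra! hne
    refine hm.exists_meromorphicOrderAt_ne_top_iff_forall.1 hne z₀ ?_
    rw [meromorphicOrderAt_eq_top_iff]
    filter_upwards [h.filter_mono nhdsWithin_le_nhds] with z hz
    simp [hz]
  ext z
  refine Filter.EventuallyEq.eq_of_nhds (((hf (mem_univ z)).eventuallyEq_nhdsNE_iff_eventuallyEq_nhds
    (hg (mem_univ z))).1 ?_)
  filter_upwards [meromorphicOrderAt_eq_top_iff.1 (htop z)] with w hw
  exact sub_eq_zero.1 hw

theorem IsSU3WittenZeta.unique {ω₁ ω₂ : ℂ → ℂ} (h₁ : IsSU3WittenZeta ω₁)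
    (h₂ : IsSU3WittenZeta ω₂) : ω₁ = ω₂ := by
  refine h₁.meromorphic.eq_of_eventuallyEq h₂.meromorphic (z₀ := 1) ?_
  filter_upwards [(isOpen_lt (continuous_const (y := (2 / 3 : ℝ))) continuous_re).mem_nhds
    (show (2 / 3 : ℝ) < (1 : ℂ).re by norm_num)] with s hs
  exact (h₁.hasSum s hs).unique (h₂.hasSum s hs)

/-- A finite limit forces nonnegative order, which in normal form means analyticity. Limits of
`cubeFinitePart` therefore determine the values of ω. -/
theorem MeromorphicNFAt.analyticAt_and_eq_of_tendsto {f : ℂ → ℂ} {z c : ℂ}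
    (hf : MeromorphicNFAt f z) (h : Tendsto f (𝓝[≠] z) (𝓝 c)) : AnalyticAt ℂ f z ∧ f z = c := by
  have ha : AnalyticAt ℂ f z := hf.meromorphicOrderAt_nonneg_iff_analyticAt.1
    ((tendsto_nhds_iff_meromorphicOrderAt_nonneg hf.meromorphicAt).1 ⟨c, h⟩)
  exact ⟨ha, tendsto_nhds_unique (ha.continuousAt.tendsto.mono_left nhdsWithin_le_nhds) h⟩

theorem IsSU3WittenZeta.analyticAt_and_eq {ω : ℂ → ℂ} (hω : IsSU3WittenZeta ω) {s c : ℂ}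
    (hs : s.re < 1) (h : Tendsto cubeFinitePart (𝓝[≠] s) (𝓝 c)) :
    AnalyticAt ℂ ω s ∧ ω s = c / 3 := by
  refine (hω.meromorphic (mem_univ s)).analyticAt_and_eq_of_tendsto ?_
  refine (h.div_const 3).congr' ?_
  rw [hω.unique isSU3WittenZeta_toMeromorphicNFOn]
  exact ((meromorphicOn_gluedWittenZeta.toMeromorphicNFOn_eq_self_on_nhdsNE (mem_univ s)).trans
    ((gluedWittenZeta_eventuallyEq hs).filter_mono nhdsWithin_le_nhds)).symm

theorem theorem3 :
    (∃! ω : ℂ → ℂ, IsSU3WittenZeta ω) ∧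
    ∀ ω : ℂ → ℂ, IsSU3WittenZeta ω →
      (AnalyticAt ℂ ω 0 ∧ ω 0 = 1 / 3) ∧
      ∀ n : ℕ, 1 ≤ n → AnalyticAt ℂ ω (-(n : ℂ)) ∧ ω (-(n : ℂ)) = 0 := by
  refine ⟨⟨_, isSU3WittenZeta_toMeromorphicNFOn, fun ω hω =>
    hω.unique isSU3WittenZeta_toMeromorphicNFOn⟩, fun ω hω =>
    ⟨hω.analyticAt_and_eq (by simp) tendsto_cubeFinitePart_zero, fun n hn => ?_⟩⟩
  have hre : (-(n : ℂ)).re < 1 := by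
    have : (0 : ℝ) ≤ n := n.cast_nonneg
    simp only [neg_re, natCast_re]
    linarith
  have h : Tendsto cubeFinitePart (𝓝[≠] (-(n : ℂ))) (𝓝 0) := by
    rcases n.even_or_odd' with ⟨m, rfl | rfl⟩
    · exact tendsto_cubeFinitePart_neg_even_pos (by omega)
    · exact tendsto_cubeFinitePart_neg_odd (odd_two_mul_add_one m)
  simpa using hω.analyticAt_and_eq hre h
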